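/- **Setting.** Let $N,K\ge 0$ be integers, $\mathcal X$ a measurable space with a non-zero base measure $\mathrm dx$, and $U^0,\dots,U^N:\mathcal X\to\mathbb R$ potentials with $Z_n:=\int_{\mathcal X}e^{-U^n(x)}\,\mathrm dx<\infty$. Put $\pi^n(\mathrm dx):=Z_n^{-1}e^{-U^n(x)}\,\mathrm dx$, $\boldsymbol\pi:=\pi^0\otimes\cdots\otimes\pi^N$, $\Delta F_n:=\log Z_{n-1}-\log Z_n$ and $\Delta F:=\log Z_0-\log Z_N$. For $n=0,\dots,N$ let $K^n$ be a $\pi^n$-invariant Markov kernel on $\mathcal X$, with $K^0(x,\cdot)=\pi^0$ for all $x$. For $n=1,\dots,N$ and $k=1,\dots,K$ let $P^{n-1}_k(x_{k-1},\mathrm dx_k)$ and $Q^n_{k-1}(x_k,\mathrm dx_{k-1})$ be Markov kernels on $\mathcal X$ such that the path measures $$\mathbb P^{n-1}_K(\mathrm dx_{0:K}):=\pi^{n-1}(\mathrm dx_0)\prod_{k=1}^KP^{n-1}_k(x_{k-1},\mathrm dx_k),\qquad \mathbb Q^{n}_K(\mathrm dx_{0:K}):=\pi^{n}(\mathrm dx_K)\prod_{k=1}^KQ^{n}_{k-1}(x_{k},\mathrm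 dx_{k-1})$$ on $\mathcal X^{K+1}$ are mutually absolutely continuous, and let $$W^n_K:=\Delta F_n-\log\frac{\mathrm d\mathbb Q^n_K}{\mathrm d\mathbb P^{n-1}_K},\qquad \alpha^n_K(x_{0:K},x'_{0:K}):=\exp\bigl(\min\{0,\,W^n_K(x'_{0:K})-W^n_K(x_{0:K})\}\bigr).$$ **Algorithm.** Let $\mathbf X_t=(X^0_t,\dots,X^N_t)$, $t\ge 0$, be generated as follows, where the law of $\mathbf X_0$ is absolutely continuous with respect to $\boldsymbol\pi$. In iteration $t\ge1$, given the past, first draw independently $Y^n_t\sim K^n(X^n_{t-1},\cdot)$ for $n=0,\dots,N$. Then, for every $n\in\{1,\dots,N\}$ with $n\equiv t \pmod 2$, draw independently a forward path $\overrightarrow X^{n-1}_{t,0:K}$ with $\overrightarrow X^{n-1}_{t,0}=Y^{n-1}_t$, $\overrightarrow X^{n-1}_{t,k}\sim P^{n-1}_k(\overrightarrow X^{n-1}_{t,k-1},\cdot)$, and a backward path $\overleftarrow X^{n}_{t,0:K}$ with $\overleftarrow X^{n}_{t,K}=Y^{n}_t$, $\overleftarrow X^{n}_{t,k-1}\sim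 Q^{n}_{k-1}(\overleftarrow X^{n}_{t,k},\cdot)$; with probability $\alpha^n_K(\overrightarrow X^{n-1}_{t,0:K},\overleftarrow X^{n}_{t,0:K})$ set $(X^{n-1}_t,X^n_t):=(\overleftarrow X^n_{t,0},\overrightarrow X^{n-1}_{t,K})$, and otherwise $(X^{n-1}_t,X^n_t):=(Y^{n-1}_t,Y^n_t)$. Components that belong to no such pair are $X^n_t:=Y^n_t$. **Estimators.** Let $\hat\pi^n_T[f]:=\frac1T\sum_{t=1}^Tf(X^n_t)$ and $\Delta\hat F_T:=\frac12(\Delta\overrightarrow F_T+\Delta\overleftarrow F_T)$, where $$e^{-\Delta\overrightarrow F_T}:=\prod_{n=1}^N\frac2T\sum_{\substack{1\le t\le T\\ t\equiv n\,(2)}}e^{-W^n_K(\overrightarrow X^{n-1}_{t,0:K})},\qquad e^{\Delta\overleftarrow F_T}:=\prod_{n=1}^N\frac2T\sum_{\substack{1\le t\le T\\ t\equiv n\,(2)}}e^{W^n_K(\overleftarrow X^{n}_{t,0:K})},$$ defined for all $T$ for which none of these sums is empty. **Proposition.** 1. For every $n\in\{0,\dots,N\}$ and every $\pi^n$-integrable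 $f:\mathcal X\to\mathbb R$, almost surely $\hat\pi^n_T[f]\to\pi^n[f]=\int f\,\mathrm d\pi^n$ as $T\to\infty$. 2. Almost surely $\Delta\hat F_T\to\Delta F$ as $T\to\infty$. 3. If $\mathbb P^{n-1}_K=\mathbb Q^n_K$ for all $n=1,\dots,N$, then for every $T$ for which $\Delta\hat F_T$ is defined, $\Delta\hat F_T=\Delta F$ almost surely. -/

import Mathlib

open MeasureTheory ProbabilityTheory Filter Topology

namespace AccelPT

noncomputable section

/-- The product kernel `x ↦ ⨂ i, κ i x` of finitely many Markov kernels. -/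
def prodKernel {ι α β : Type*} [Fintype ι] [MeasurableSpace α] [MeasurableSpace β]
    (κ : ι → Kernel α β) [∀ i, IsMarkovKernel (κ i)] : Kernel α (ι → β) where
  toFun x := Measure.pi fun i => κ i x
  measurable' := by
    refine Measurable.measure_of_isPiSystem_of_isProbabilityMeasure generateFrom_pi.symm
      isPiSystem_pi ?_
    rintro _ ⟨s, hs, rfl⟩
    simp only [Measure.pi_pi]
    exact Finset.measurable_prod _ fun i _ =>
      Kernel.measurable_coe _ (hs i (Set.mem_univ i))

instance {ι α β : Type*} [Fintype ι] [MeasurableSpace α] [MeasurableSpace β]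
    (κ : ι → Kernel α β) [∀ i, IsMarkovKernel (κ i)] : IsMarkovKernel (prodKernel κ) :=
  ⟨fun x => inferInstanceAs (IsProbabilityMeasure (Measure.pi fun i => κ i x))⟩

/-- The law of the path `(x₀, …, x_K)` started at `x₀`, with `x_{k+1} ∼ P k (x_k, ·)`
for `k = 0, …, K - 1`. -/
def pathKernel {𝓧 : Type*} [MeasurableSpace 𝓧] :
    (K : ℕ) → (Fin K → Kernel 𝓧 𝓧) → Kernel 𝓧 (Fin (K + 1) → 𝓧)
  | 0, _ => Kernel.deterministic (fun x _ => x) (by fun_prop)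
  | K + 1, P =>
      (Kernel.id ×ₖ (pathKernel K (fun k => P k.succ) ∘ₖ P 0)).map
        fun p => Fin.cons (α := fun _ => 𝓧) p.1 p.2

theorem measurable_cons {𝓧 : Type*} [MeasurableSpace 𝓧] (K : ℕ) :
    Measurable fun p : 𝓧 × (Fin (K + 1) → 𝓧) => Fin.cons (α := fun _ => 𝓧) p.1 p.2 := by
  refine measurable_pi_lambda _ fun i => ?_
  refine Fin.cases ?_ (fun i => ?_) i
  · simpa using measurable_fst
  · simp only [Fin.cons_succ]
    fun_prop

instance isMarkovKernel_pathKernel {𝓧 : Type*} [MeasurableSpace 𝓧] :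
    (K : ℕ) → (P : Fin K → Kernel 𝓧 𝓧) → [∀ k, IsMarkovKernel (P k)] →
      IsMarkovKernel (pathKernel K P)
  | 0, _, _ => by unfold pathKernel; infer_instance
  | K + 1, P, _ => by
      have := isMarkovKernel_pathKernel K (fun k => P k.succ)
      unfold pathKernel
      exact Kernel.IsMarkovKernel.map _ (measurable_cons K)

/-- The law of the path `(x₀, …, x_K)` run backwards from `x_K`, with
`x_k ∼ Q k (x_{k+1}, ·)` for `k = K - 1, …, 0`. -/
def revPathKernel {𝓧 : Type*} [MeasurableSpace 𝓧] (K : ℕ) (Q : Fin K → Kernel 𝓧 𝓧) :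
    Kernel 𝓧 (Fin (K + 1) → 𝓧) :=
  (pathKernel K fun k => Q k.rev).map fun y i => y i.rev

instance {𝓧 : Type*} [MeasurableSpace 𝓧] (K : ℕ) (Q : Fin K → Kernel 𝓧 𝓧)
    [∀ k, IsMarkovKernel (Q k)] : IsMarkovKernel (revPathKernel K Q) :=
  Kernel.IsMarkovKernel.map _ (by fun_prop)

/-- The data of accelerated parallel tempering with `N + 1` chains and `K` acceleration steps.
The swap between chains `n - 1` and `n` (`n = 1, …, N`) is indexed by `j : Fin N`, `n = j + 1`;
so chain `n - 1` is `j.castSucc` and chain `n` is `j.succ`. -/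
structure Data (N K : ℕ) (𝓧 : Type*) [MeasurableSpace 𝓧] where
  /-- the base measure `dx` -/
  base : Measure 𝓧
  /-- the potentials `Uⁿ` -/
  U : Fin (N + 1) → 𝓧 → ℝ
  /-- the local exploration kernels `Kⁿ` -/
  explore : Fin (N + 1) → Kernel 𝓧 𝓧
  /-- `fwd j k` is the forward accelerator `P^{n-1}_{k+1}(x_k, dx_{k+1})`, `n = j + 1` -/
  fwd : Fin N → Fin K → Kernel 𝓧 𝓧
  /-- `bwd j k` is the backward accelerator `Q^n_k(x_{k+1}, dx_k)`, `n = j + 1` -/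
  bwd : Fin N → Fin K → Kernel 𝓧 𝓧
  explore_markov : ∀ n, IsMarkovKernel (explore n)
  fwd_markov : ∀ j k, IsMarkovKernel (fwd j k)
  bwd_markov : ∀ j k, IsMarkovKernel (bwd j k)

attribute [instance] Data.explore_markov Data.fwd_markov Data.bwd_markov

/-- States of all chains. -/
abbrev State (N : ℕ) (𝓧 : Type*) := Fin (N + 1) → 𝓧

/-- Paths `x_{0:K}`. -/
abbrev Path (K : ℕ) (𝓧 : Type*) := Fin (K + 1) → 𝓧

/-- What is sampled for one swap move: the forward path, the backward path, and the uniform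
variable deciding about acceptance. -/
abbrev Draw (K : ℕ) (𝓧 : Type*) := Path K 𝓧 × Path K 𝓧 × unitInterval

/-- The swap between chains `n - 1` and `n`, `n = j + 1`, is proposed at iteration `t` iff
`n ≡ t mod 2`. -/
def Proposed {N : ℕ} (t : ℕ) (j : Fin N) : Prop := (j : ℕ) + 1 ≡ t [MOD 2]

instance {N : ℕ} (t : ℕ) : DecidablePred (Proposed (N := N) t) := fun j =>
  inferInstanceAs (Decidable ((j : ℕ) + 1 ≡ t [MOD 2]))

namespace Data

variable {N K : ℕ} {𝓧 : Type*} [MeasurableSpace 𝓧] (S : Data N K 𝓧)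

/-- The normalising constant `Z_n = ∫ exp(-Uⁿ(x)) dx`. -/
def Z (n : Fin (N + 1)) : ℝ := ∫ x, Real.exp (-S.U n x) ∂S.base

/-- The annealing distribution `πⁿ(dx) = exp(-Uⁿ(x)) / Z_n dx`. -/
def π (n : Fin (N + 1)) : Measure 𝓧 := S.base.tilted fun x => -S.U n x

/-- The joint distribution `π⁰ ⊗ ⋯ ⊗ π^N`. -/
def jointπ : Measure (State N 𝓧) := Measure.pi S.π

/-- `ΔF_n = log Z_{n-1} - log Z_n`, `n = j + 1`. -/
def ΔFstep (j : Fin N) : ℝ := Real.log (S.Z j.castSucc) - Real.log (S.Z j.succ)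

/-- The free energy difference `ΔF = log Z_0 - log Z_N`. -/
def ΔF : ℝ := Real.log (S.Z 0) - Real.log (S.Z (Fin.last N))

/-- The forward path measure `ℙ^{n-1}_K`, `n = j + 1`. -/
def fwdLaw (j : Fin N) : Measure (Path K 𝓧) := (S.π j.castSucc).bind (pathKernel K (S.fwd j))

/-- The backward path measure `ℚ^n_K`, `n = j + 1`. -/
def bwdLaw (j : Fin N) : Measure (Path K 𝓧) := (S.π j.succ).bind (revPathKernel K (S.bwd j))

/-- The standing assumptions. -/
structure Valid : Prop where
  base_ne_zero : S.base ≠ 0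
  integrable_exp : ∀ n, Integrable (fun x => Real.exp (-S.U n x)) S.base
  explore_invariant : ∀ n, Kernel.Invariant (S.explore n) (S.π n)
  /-- the exploration move of the reference chain is an independent draw from the reference -/
  explore_zero : S.explore 0 = Kernel.const 𝓧 (S.π 0)
  fwd_ac_bwd : ∀ j, S.fwdLaw j ≪ S.bwdLaw j
  bwd_ac_fwd : ∀ j, S.bwdLaw j ≪ S.fwdLaw j

/-- The work `W^n_K = ΔF_n - log (dℚ^n_K / dℙ^{n-1}_K)`, `n = j + 1`. -/
def work (j : Fin N) (x : Path K 𝓧) : ℝ :=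
  S.ΔFstep j - Real.log (((S.bwdLaw j).rnDeriv (S.fwdLaw j) x).toReal)

/-- The acceptance probability `α^n_K(x_{0:K}, x'_{0:K})` of the swap, `n = j + 1`. -/
def accept (j : Fin N) (x x' : Path K 𝓧) : ℝ :=
  Real.exp (min 0 (S.work j x' - S.work j x))

/-- The local exploration step, moving all chains independently. -/
def exploreKernel : Kernel (State N 𝓧) (State N 𝓧) :=
  prodKernel fun n => (S.explore n).comap (fun x => x n) (measurable_pi_apply n)

/-- Sampling of what the swap `j` needs, given the state after local exploration: the forward path
from chain `n - 1`, the backward path from chain `n`, and a uniform variable, independently. -/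
def drawKernel (j : Fin N) : Kernel (State N 𝓧) (Draw K 𝓧) :=
  ((pathKernel K (S.fwd j)).comap (fun x => x j.castSucc) (measurable_pi_apply _)) ×ₖ
    (((revPathKernel K (S.bwd j)).comap (fun x => x j.succ) (measurable_pi_apply _)) ×ₖ
      Kernel.const _ (volume : Measure unitInterval))

instance (j : Fin N) : IsMarkovKernel (S.drawKernel j) := by
  unfold drawKernel; infer_instance

/-- All the sampling of iteration `t`, given the state after iteration `t - 1`: local exploration,
followed by independent draws for the swaps proposed at iteration `t`. -/
def iterKernel (t : ℕ) :
    Kernel (State N 𝓧) (State N 𝓧 × ({j : Fin N // Proposed t j} → Draw K 𝓧)) :=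
  S.exploreKernel ⊗ₖ Kernel.prodMkLeft _
    (prodKernel fun j : {j : Fin N // Proposed t j} => S.drawKernel j.1)

/-- The swap is carried out iff the uniform variable is below the acceptance probability. -/
def Accepted (j : Fin N) (d : Draw K 𝓧) : Prop :=
  (d.2.2 : ℝ) < S.accept j d.1 d.2.1

open Classical in
/-- The state after the communication step of iteration `t`, given the state `y` after local
exploration and the draws `d` (which are read only for the swaps proposed at iteration `t`). In an
accepted swap between chains `n - 1` and `n`, chain `n` receives the end point of the forward path
and chain `n - 1` the starting point of the backward path. -/
def communicate (t : ℕ) (y : State N 𝓧) (d : Fin N → Draw K 𝓧) : State N 𝓧 := fun i =>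
  if h : 0 < (i : ℕ) ∧ (i : ℕ) ≡ t [MOD 2] then
    let j : Fin N := ⟨i - 1, by omega⟩
    if S.Accepted j (d j) then (d j).1 (Fin.last K) else y i
  else if h : (i : ℕ) < N ∧ (i : ℕ) + 1 ≡ t [MOD 2] then
    let j : Fin N := ⟨i, h.1⟩
    if S.Accepted j (d j) then (d j).2.1 0 else y i
  else y i

/-- `X 0, X 1, …` is generated by accelerated parallel tempering, on a probability space with a
filtration `ℱ`: in iteration `t + 1`, conditionally on `ℱ t`, the state `Y (t + 1)` after local
exploration and the draws `D (t + 1) j` for the proposed swaps are sampled from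
`S.iterKernel (t + 1) (X t)`, and the communication step then yields `X (t + 1)`.
The law of the initial state is absolutely continuous with respect to `π⁰ ⊗ ⋯ ⊗ π^N`. -/
structure IsRun {Ω : Type*} {mΩ : MeasurableSpace Ω} (μ : Measure Ω) (ℱ : Filtration ℕ mΩ)
    (X Y : ℕ → Ω → State N 𝓧) (D : ℕ → Fin N → Ω → Draw K 𝓧) : Prop where
  measurable_X : ∀ t, Measurable[ℱ t] (X t)
  measurable_Y : ∀ t, Measurable[ℱ (t + 1)] (Y (t + 1))
  measurable_D : ∀ t j, Proposed (t + 1) j → Measurable[ℱ (t + 1)] (D (t + 1) j)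
  init : μ.map (X 0) ≪ S.jointπ
  sample : ∀ t (A : Set Ω), MeasurableSet[ℱ t] A →
    ∀ B : Set (State N 𝓧 × ({j : Fin N // Proposed (t + 1) j} → Draw K 𝓧)), MeasurableSet B →
      μ (A ∩ (fun ω => (Y (t + 1) ω, fun j => D (t + 1) j.1 ω)) ⁻¹' B) =
        ∫⁻ ω in A, S.iterKernel (t + 1) (X t ω) B ∂μ
  update : ∀ t, ∀ᵐ ω ∂μ, X (t + 1) ω = S.communicate (t + 1) (Y (t + 1) ω) fun j => D (t + 1) j ω

variable {Ω : Type*}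

/-- The estimator `exp(-ΔF_T) = ∏ n, (2 / T) ∑_{t ≤ T, t ≡ n mod 2} exp(-W^n_K)` of `ΔF` from the
forward paths. -/
def fwdFreeEnergy (D : ℕ → Fin N → Ω → Draw K 𝓧) (T : ℕ) (ω : Ω) : ℝ :=
  -Real.log (∏ j : Fin N, (2 / (T : ℝ)) *
    ∑ t ∈ Finset.Icc 1 T with Proposed t j, Real.exp (-S.work j (D t j ω).1))

/-- The estimator `exp(ΔF_T) = ∏ n, (2 / T) ∑_{t ≤ T, t ≡ n mod 2} exp(W^n_K)` of `ΔF` from the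
backward paths. -/
def bwdFreeEnergy (D : ℕ → Fin N → Ω → Draw K 𝓧) (T : ℕ) (ω : Ω) : ℝ :=
  Real.log (∏ j : Fin N, (2 / (T : ℝ)) *
    ∑ t ∈ Finset.Icc 1 T with Proposed t j, Real.exp (S.work j (D t j ω).2.1))

/-- The free energy estimator, the mean of the forward and the backward one. -/
def freeEnergy (D : ℕ → Fin N → Ω → Draw K 𝓧) (T : ℕ) (ω : Ω) : ℝ :=
  (S.fwdFreeEnergy D T ω + S.bwdFreeEnergy D T ω) / 2

end Data

/-- The Monte Carlo average of `f` over the first `T` states of the `n`-th chain. -/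
def chainAverage {N : ℕ} {𝓧 Ω : Type*} (X : ℕ → Ω → State N 𝓧) (n : Fin (N + 1)) (f : 𝓧 → ℝ)
    (T : ℕ) (ω : Ω) : ℝ :=
  (1 / (T : ℝ)) * ∑ t ∈ Finset.Icc 1 T, f (X t ω n)

end

end AccelPT

/-!
A proposed swap is a Metropolis step: the acceptance probability is the Metropolis ratio for
exchanging the forward and the backward path, so it leaves `π^{n-1} ⊗ π^n` invariant, and every
iteration leaves `π⁰ ⊗ ⋯ ⊗ π^N` invariant. Every proposed swap is accepted with positive
probability, hence an independent draw of the chain `0` can be carried by successive swaps to any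
chain; within `2(N + 1)` iterations this replaces all components, so from every state the law of
the chain then dominates `π⁰ ⊗ ⋯ ⊗ π^N`. Consequently bounded harmonic functions are almost
everywhere constant, the shift on the stationary trajectories is ergodic, and Birkhoff's theorem
gives the law of large numbers, first under the stationary law and then under every initial law
which is absolutely continuous with respect to it. As the transitions alternate, time homogeneity
holds for the records made of the parity, the explored state and the drawn paths.

The means of `exp(-W)` over forward paths and of `exp W` over backward paths are `exp(-ΔF_n)` and
`exp ΔF_n`, since `exp(ΔF_n - W)` is the density of the backward path measure with respect to the
forward one. If the two path measures agree then `W = ΔF_n` almost surely, and the number of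
summands cancels between the forward and the backward estimator.
-/

namespace AccelPT

open scoped ENNReal

section Birkhoff

variable {α : Type*} {T : α → α} {f : α → ℝ}

/-- The maximum of the Birkhoff sums `S₁, …, S_{n+1}` of `f` along `T`, written recursively by
means of `S_{k+1}(x) = f x + S_k(T x)`. -/
noncomputable def birkhoffMax (T : α → α) (f : α → ℝ) : ℕ → α → ℝ
  | 0, x => f x
  | n + 1, x => f x + max 0 (birkhoffMax T f n (T x))

theorem birkhoffMax_le_succ (n : ℕ) (x : α) : birkhoffMax T f n x ≤ birkhoffMax T f (n + 1) x := by
  induction n generalizing x with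
  | zero => simp [birkhoffMax]
  | succ n ih =>
    rw [birkhoffMax, birkhoffMax]
    gcongr
    exact ih _

theorem monotone_birkhoffMax (x : α) : Monotone fun n => birkhoffMax T f n x :=
  monotone_nat_of_le_succ fun n => birkhoffMax_le_succ n x

theorem birkhoffSum_le_birkhoffMax (n : ℕ) (x : α) :
    birkhoffSum T f (n + 1) x ≤ birkhoffMax T f n x := by
  induction n generalizing x with
  | zero => simp [birkhoffMax]
  | succ n ih =>
    rw [birkhoffMax, birkhoffSum_succ']
    gcongr
    exact (ih _).trans (le_max_right _ _)

theorem birkhoffMax_succ_sub_comp (n : ℕ) (x : α) :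
    birkhoffMax T f (n + 1) x - birkhoffMax T f n (T x) =
      f x + max (-birkhoffMax T f n (T x)) 0 := by
  rw [birkhoffMax, add_sub_assoc, ← max_sub_sub_right, zero_sub, sub_self]

theorem abs_birkhoffMax_succ_sub_comp_le (n : ℕ) (x : α) :
    |birkhoffMax T f (n + 1) x - birkhoffMax T f n (T x)| ≤ |f x| + |f (T x)| := by
  have hmax : f (T x) ≤ birkhoffMax T f n (T x) := monotone_birkhoffMax (T x) (Nat.zero_le n)
  have hneg : max (-birkhoffMax T f n (T x)) 0 ≤ |f (T x)| :=
    max_le (by linarith [neg_abs_le (f (T x))]) (abs_nonneg _)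
  rw [birkhoffMax_succ_sub_comp]
  refine (abs_add_le _ _).trans ?_
  rw [abs_of_nonneg (le_max_right (-birkhoffMax T f n (T x)) 0)]
  gcongr

theorem bddAbove_birkhoffMax_comp_iff (x : α) :
    BddAbove (Set.range fun n => birkhoffMax T f n (T x)) ↔
      BddAbove (Set.range fun n => birkhoffMax T f n x) := by
  constructor
  · rintro ⟨C, hC⟩
    have hC' (n) : birkhoffMax T f n (T x) ≤ C := hC ⟨n, rfl⟩
    refine ⟨f x + max 0 C, ?_⟩
    rintro _ ⟨n, rfl⟩
    refine (birkhoffMax_le_succ n x).trans ?_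
    rw [birkhoffMax]
    gcongr
    exact hC' n
  · rintro ⟨C, hC⟩
    have hC' (n) : f x + max 0 (birkhoffMax T f n (T x)) ≤ C := hC ⟨n + 1, rfl⟩
    refine ⟨C - f x, ?_⟩
    rintro _ ⟨n, rfl⟩
    linarith [hC' n, le_max_right 0 (birkhoffMax T f n (T x))]

theorem bddAbove_birkhoffSum_of_bddAbove_birkhoffMax {x : α}
    (h : BddAbove (Set.range fun n => birkhoffMax T f n x)) :
    BddAbove (Set.range fun n => birkhoffSum T f n x) := by
  obtain ⟨C, hC⟩ := h
  refine ⟨max 0 C, ?_⟩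
  rintro _ ⟨_ | n, rfl⟩
  · simp
  · exact (birkhoffSum_le_birkhoffMax n x).trans ((hC ⟨n, rfl⟩).trans (le_max_right _ _))

theorem eventually_birkhoffAverage_lt_of_bddAbove {c a : ℝ} (hca : c < a) {x : α}
    (h : BddAbove (Set.range fun n => birkhoffSum T (fun y => f y - c) n x)) :
    ∀ᶠ n in atTop, birkhoffAverage ℝ T f n x < a := by
  obtain ⟨C, hC⟩ := h
  have hsum (n : ℕ) : birkhoffSum T f n x - n * c ≤ C := by
    simpa [birkhoffSum, Finset.sum_sub_distrib] using hC ⟨n, rfl⟩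
  have hlim : Tendsto (fun n : ℕ => c + C * (n : ℝ)⁻¹) atTop (𝓝 (c + C * 0)) :=
    (tendsto_inv_atTop_nhds_zero_nat.const_mul C).const_add _
  filter_upwards [hlim.eventually_lt_const (u := a) (by linarith), eventually_gt_atTop 0]
    with n hn hn0
  have hn0' : (n : ℝ) ≠ 0 := Nat.cast_ne_zero.2 hn0.ne'
  calc birkhoffAverage ℝ T f n x = (n : ℝ)⁻¹ * birkhoffSum T f n x := rfl
    _ ≤ (n : ℝ)⁻¹ * (n * c + C) := by gcongr; linarith [hsum n]
    _ = c + C * (n : ℝ)⁻¹ := by field_simp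
    _ < a := hn

variable [MeasurableSpace α] {μ : Measure α}

theorem measurable_birkhoffMax (hT : Measurable T) (hf : Measurable f) (n : ℕ) :
    Measurable (birkhoffMax T f n) := by
  induction n with
  | zero => exact hf
  | succ n ih => exact hf.add (measurable_const.max (ih.comp hT))

theorem integrable_birkhoffMax (hT : MeasurePreserving T μ μ) (hf : Integrable f μ) (n : ℕ) :
    Integrable (birkhoffMax T f n) μ := by
  induction n with
  | zero => exact hf
  | succ n ih =>
    exact hf.add ((integrable_zero α ℝ μ).sup (hT.integrable_comp_of_integrable ih))

theorem integral_birkhoffMax_succ_sub_comp_nonneg (hT : MeasurePreserving T μ μ)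
    (hf : Integrable f μ) (n : ℕ) :
    0 ≤ ∫ x, (birkhoffMax T f (n + 1) x - birkhoffMax T f n (T x)) ∂μ := by
  have integrable_max := integrable_birkhoffMax hT hf
  have integrable_shifted : Integrable (fun x => birkhoffMax T f n (T x)) μ :=
    hT.integrable_comp_of_integrable (integrable_max n)
  have hcomp : ∫ x, birkhoffMax T f n (T x) ∂μ = ∫ x, birkhoffMax T f n x ∂μ :=
    hT.hasLaw.integral_comp (integrable_max n).aestronglyMeasurable
  rw [integral_sub (integrable_max _) integrable_shifted, hcomp, sub_nonneg]
  exact integral_mono (integrable_max _) (integrable_max _) fun x => birkhoffMax_le_succ n x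

/-- Where the maxima `M_n` are unbounded, `M_{n+1} - M_n ∘ T` is eventually `f`, and its integrals
are nonnegative because `M_n` increases with `n`. -/
theorem integral_nonneg_of_ae_not_bddAbove_birkhoffMax (hT : MeasurePreserving T μ μ)
    (hf : Integrable f μ)
    (h : ∀ᵐ x ∂μ, ¬ BddAbove (Set.range fun n => birkhoffMax T f n x)) : 0 ≤ ∫ x, f x ∂μ := by
  have integrable_max := integrable_birkhoffMax hT hf
  have hlim : Tendsto (fun n => ∫ x, (birkhoffMax T f (n + 1) x - birkhoffMax T f n (T x)) ∂μ)
      atTop (𝓝 (∫ x, f x ∂μ)) := by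
    refine tendsto_integral_of_dominated_convergence (fun x => |f x| + |f (T x)|)
      (fun n => ((integrable_max _).sub
        (hT.integrable_comp_of_integrable (integrable_max n))).aestronglyMeasurable)
      (hf.abs.add (hT.integrable_comp_of_integrable hf).abs)
      (fun n => .of_forall fun x => abs_birkhoffMax_succ_sub_comp_le n x) ?_
    filter_upwards [h] with x hx
    rw [← bddAbove_birkhoffMax_comp_iff, not_bddAbove_iff] at hx
    obtain ⟨_, ⟨n₀, rfl⟩, hn₀⟩ := hx 0
    refine tendsto_const_nhds.congr' ?_
    filter_upwards [eventually_ge_atTop n₀] with n hn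
    have hpos : 0 < birkhoffMax T f n (T x) := hn₀.trans_le (monotone_birkhoffMax (T x) hn)
    rw [birkhoffMax_succ_sub_comp, max_eq_right (neg_nonpos.2 hpos.le), add_zero]
  exact ge_of_tendsto' hlim (integral_birkhoffMax_succ_sub_comp_nonneg hT hf)

theorem ae_bddAbove_birkhoffSum_of_integral_neg (hT : Ergodic T μ) (hfm : Measurable f)
    (hf : Integrable f μ) (hneg : ∫ x, f x ∂μ < 0) :
    ∀ᵐ x ∂μ, BddAbove (Set.range fun n => birkhoffSum T f n x) := by
  have hmeas : MeasurableSet {x | BddAbove (Set.range fun n => birkhoffMax T f n x)} :=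
    measurableSet_bddAbove_range (measurable_birkhoffMax hT.measurable hfm)
  have hinv : T ⁻¹' {x | BddAbove (Set.range fun n => birkhoffMax T f n x)} =
      {x | BddAbove (Set.range fun n => birkhoffMax T f n x)} :=
    Set.ext bddAbove_birkhoffMax_comp_iff
  rcases hT.toPreErgodic.ae_mem_or_ae_notMem hmeas hinv with h | h
  · exact h.mono fun x => bddAbove_birkhoffSum_of_bddAbove_birkhoffMax
  · exact absurd (integral_nonneg_of_ae_not_bddAbove_birkhoffMax hT.toMeasurePreserving hf h)
      hneg.not_ge

variable [IsProbabilityMeasure μ]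

theorem ae_eventually_birkhoffAverage_lt (hT : Ergodic T μ) (hfm : Measurable f)
    (hf : Integrable f μ) {a : ℝ} (ha : ∫ x, f x ∂μ < a) :
    ∀ᵐ x ∂μ, ∀ᶠ n in atTop, birkhoffAverage ℝ T f n x < a := by
  obtain ⟨c, hc, hca⟩ := exists_between ha
  have hneg : ∫ x, (f x - c) ∂μ < 0 := by
    rw [integral_sub hf (integrable_const c)]
    simpa using hc
  exact (ae_bddAbove_birkhoffSum_of_integral_neg hT (hfm.sub_const c)
    (hf.sub (integrable_const c)) hneg).mono fun x => eventually_birkhoffAverage_lt_of_bddAbove hca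

theorem ae_forall_eventually_birkhoffAverage_lt (hT : Ergodic T μ) (hfm : Measurable f)
    (hf : Integrable f μ) :
    ∀ᵐ x ∂μ, ∀ a > ∫ y, f y ∂μ, ∀ᶠ n in atTop, birkhoffAverage ℝ T f n x < a := by
  have h : ∀ᵐ x ∂μ, ∀ k : ℕ, ∀ᶠ n in atTop,
      birkhoffAverage ℝ T f n x < ∫ y, f y ∂μ + 1 / (k + 1) :=
    ae_all_iff.2 fun k =>
      ae_eventually_birkhoffAverage_lt hT hfm hf (lt_add_of_pos_right _ (by positivity))
  filter_upwards [h] with x hx a ha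
  obtain ⟨k, hk⟩ := exists_nat_one_div_lt (sub_pos.2 ha)
  filter_upwards [hx k] with n hn
  linarith

theorem ae_tendsto_birkhoffAverage_of_measurable (hT : Ergodic T μ) (hfm : Measurable f)
    (hf : Integrable f μ) :
    ∀ᵐ x ∂μ, Tendsto (fun n => birkhoffAverage ℝ T f n x) atTop (𝓝 (∫ y, f y ∂μ)) := by
  filter_upwards [ae_forall_eventually_birkhoffAverage_lt hT hfm hf,
    ae_forall_eventually_birkhoffAverage_lt hT hfm.neg hf.neg] with x hupper hlower
  refine tendsto_order.2 ⟨fun a ha => ?_, hupper⟩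
  have hneg : ∫ y, (-f) y ∂μ < -a := by simpa [integral_neg] using ha
  filter_upwards [hlower (-a) hneg] with n hn
  simpa [birkhoffAverage_neg] using hn

theorem ae_tendsto_birkhoffAverage (hT : Ergodic T μ) (hf : Integrable f μ) :
    ∀ᵐ x ∂μ, Tendsto (fun n => birkhoffAverage ℝ T f n x) atTop (𝓝 (∫ y, f y ∂μ)) := by
  have hfg := hf.aestronglyMeasurable.ae_eq_mk
  have hlim := ae_tendsto_birkhoffAverage_of_measurable hT
    hf.aestronglyMeasurable.stronglyMeasurable_mk.measurable (hf.congr hfg)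
  have heq := ae_all_iff.2 fun n =>
    hT.quasiMeasurePreserving.birkhoffAverage_ae_eq_of_ae_eq ℝ hfg n
  filter_upwards [hlim, heq] with x hx hx'
  rw [integral_congr_ae hfg]
  exact hx.congr fun n => (hx' n).symm

end Birkhoff

theorem ae_mem_of_map_eq_dirac {α β : Type*} [MeasurableSpace α] [MeasurableSpace β]
    {m : Measure α} {f : α → β} (hf : Measurable f) {b : β} (h : m.map f = Measure.dirac b)
    {s : Set β} (hs : MeasurableSet s) (hb : b ∈ s) : ∀ᵐ x ∂m, f x ∈ s := by
  refine ae_of_ae_map (p := fun y => y ∈ s) hf.aemeasurable ?_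
  rw [h]
  exact (ae_dirac_iff hs).2 hb

theorem map_prodMk_of_map_eq_dirac {α β : Type*} [MeasurableSpace α] [MeasurableSpace β]
    {m : Measure α} [SigmaFinite m] {f : α → β} (hf : Measurable f) {b : β}
    (h : m.map f = Measure.dirac b) : m.map (fun x => (f x, x)) = (Measure.dirac b).prod m := by
  symm
  refine Measure.prod_eq fun s t hs ht => ?_
  rw [Measure.map_apply (by fun_prop) (hs.prod ht), Measure.dirac_apply' _ hs]
  by_cases hb : b ∈ s
  · rw [Set.indicator_of_mem hb, Pi.one_apply, one_mul]
    refine measure_congr ?_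
    filter_upwards [ae_mem_of_map_eq_dirac hf h hs hb] with x hx
    exact propext ⟨And.right, And.intro hx⟩
  · rw [Set.indicator_of_notMem hb, zero_mul]
    have hnull := ae_iff.1 (ae_mem_of_map_eq_dirac hf h hs.compl hb)
    simp only [Set.mem_compl_iff, not_not] at hnull
    exact measure_mono_null (fun x hx => hx.1) hnull

section MarkovChain

variable {E : Type*}

/-- The left shift of sequences. -/
def shift (p : ℕ → E) (i : ℕ) : E := p (i + 1)

theorem iterate_shift_apply (k : ℕ) (p : ℕ → E) (i : ℕ) : shift^[k] p i = p (i + k) := by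
  induction k generalizing p with
  | zero => rfl
  | succ k ih =>
    rw [Function.iterate_succ_apply, ih]
    rfl

theorem pi_Iio_succ (n : ℕ) (B : ℕ → Set E) :
    (Set.Iio (n + 1)).pi B =
      {p | p 0 ∈ B 0} ∩ shift ⁻¹' (Set.Iio n).pi fun i => B (i + 1) := by
  ext p
  constructor
  · exact fun h => ⟨h 0 n.succ_pos, fun i hi => h (i + 1) (Nat.succ_lt_succ hi)⟩
  · rintro ⟨h₀, h⟩ (_ | i) hi
    exacts [h₀, h i (Nat.lt_of_succ_lt_succ hi)]

variable [MeasurableSpace E]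

theorem measurable_shift : Measurable (shift (E := E)) :=
  measurable_pi_lambda _ fun i => measurable_pi_apply (i + 1)

theorem measurableSet_pi_Iio (n : ℕ) {B : ℕ → Set E} (hB : ∀ i, MeasurableSet (B i)) :
    MeasurableSet ((Set.Iio n).pi B) :=
  .pi (Set.to_countable _) fun i _ => hB i

theorem measure_ext_of_pi_Iio {M M' : Measure (ℕ → E)} [IsFiniteMeasure M]
    (h : ∀ n (B : ℕ → Set E), (∀ i, MeasurableSet (B i)) →
      M ((Set.Iio n).pi B) = M' ((Set.Iio n).pi B)) :
    M = M' := by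
  refine ext_of_generate_finite _ generateFrom_squareCylinders.symm
    (isPiSystem_squareCylinders (fun _ => MeasurableSpace.isPiSystem_measurableSet)
      fun _ => MeasurableSet.univ) ?_ ?_
  · classical
    rintro _ ⟨s, B, hB, rfl⟩
    have hbox : (s : Set ℕ).pi B =
        (Set.Iio (s.sup id + 1)).pi fun i => if i ∈ s then B i else Set.univ := by
      ext p
      refine ⟨fun hp i _ => ?_, fun hp i hi => ?_⟩
      · dsimp only
        split_ifs with hi
        exacts [hp i hi, trivial]
      · simpa only [if_pos (Finset.mem_coe.1 hi)] using
          hp i (Nat.lt_succ_of_le (Finset.le_sup (f := id) hi))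
    rw [hbox]
    refine h _ _ fun i => ?_
    split_ifs
    exacts [hB i trivial, MeasurableSet.univ]
  · simpa using h 0 (fun _ => Set.univ) fun _ => MeasurableSet.univ

/-- `V` is, with respect to the filtration `ℱ`, a Markov chain with transition kernel `κ`. -/
structure IsMarkovChain {Ω : Type*} {mΩ : MeasurableSpace Ω} (κ : Kernel E E) (μ : Measure Ω)
    (ℱ : Filtration ℕ mΩ) (V : ℕ → Ω → E) : Prop where
  adapted : ∀ t, Measurable[ℱ t] (V t)
  markov : ∀ t (A : Set Ω), MeasurableSet[ℱ t] A → ∀ B : Set E, MeasurableSet B →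
    μ (A ∩ V (t + 1) ⁻¹' B) = ∫⁻ ω in A, κ (V t ω) B ∂μ

/-- The probability that a chain started at `x` with transition kernel `κ` visits
`B 0, …, B (n - 1)` at the times `0, …, n - 1`. -/
noncomputable def boxProb (κ : Kernel E E) : ℕ → (ℕ → Set E) → E → ℝ≥0∞
  | 0, _, _ => 1
  | n + 1, B, x => (B 0).indicator (fun x => ∫⁻ y, boxProb κ n (fun i => B (i + 1)) y ∂κ x) x

theorem measurable_boxProb (κ : Kernel E E) (n : ℕ) {B : ℕ → Set E}
    (hB : ∀ i, MeasurableSet (B i)) : Measurable (boxProb κ n B) := by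
  induction n generalizing B with
  | zero => exact measurable_const
  | succ n ih => exact (ih fun i => hB (i + 1)).lintegral_kernel.indicator (hB 0)

namespace IsMarkovChain

variable {Ω : Type*} {mΩ : MeasurableSpace Ω} {κ : Kernel E E} {μ : Measure Ω}
  {ℱ : Filtration ℕ mΩ} {V : ℕ → Ω → E}

theorem measurable (h : IsMarkovChain κ μ ℱ V) (t : ℕ) : Measurable (V t) :=
  (h.adapted t).mono (ℱ.le t) le_rfl

theorem map_restrict_succ (h : IsMarkovChain κ μ ℱ V) {t : ℕ} {A : Set Ω}
    (hA : MeasurableSet[ℱ t] A) :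
    (μ.restrict A).map (V (t + 1)) = ((μ.restrict A).map (V t)).bind κ := by
  ext B hB
  rw [Measure.map_apply (h.measurable _) hB, Measure.bind_apply hB κ.aemeasurable,
    lintegral_map (Kernel.measurable_coe κ hB) (h.measurable t),
    Measure.restrict_apply (h.measurable _ hB), Set.inter_comm, h.markov t A hA B hB]

theorem map_succ (h : IsMarkovChain κ μ ℱ V) (t : ℕ) :
    μ.map (V (t + 1)) = (μ.map (V t)).bind κ := by
  simpa only [Measure.restrict_univ] using h.map_restrict_succ (t := t) MeasurableSet.univ

theorem setLIntegral_succ (h : IsMarkovChain κ μ ℱ V) {t : ℕ} {A : Set Ω}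
    (hA : MeasurableSet[ℱ t] A) {g : E → ℝ≥0∞} (hg : Measurable g) :
    ∫⁻ ω in A, g (V (t + 1) ω) ∂μ = ∫⁻ ω in A, ∫⁻ y, g y ∂κ (V t ω) ∂μ := by
  rw [← lintegral_map hg (h.measurable _), h.map_restrict_succ hA,
    Measure.lintegral_bind κ.aemeasurable hg.aemeasurable,
    lintegral_map hg.lintegral_kernel (h.measurable t)]

theorem map_absolutelyContinuous (h : IsMarkovChain κ μ ℱ V) {Γ : Measure E}
    (hinv : κ.Invariant Γ) (hac : μ.map (V 0) ≪ Γ) (t : ℕ) : μ.map (V t) ≪ Γ := by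
  induction t with
  | zero => exact hac
  | succ t ih =>
    rw [h.map_succ, ← hinv.def]
    exact ih.comp_right κ

theorem measure_inter_preimage_pi_Iio (h : IsMarkovChain κ μ ℱ V) (n t : ℕ) {A : Set Ω}
    (hA : MeasurableSet[ℱ t] A) {B : ℕ → Set E} (hB : ∀ i, MeasurableSet (B i)) :
    μ (A ∩ (fun ω i => V (t + i) ω) ⁻¹' (Set.Iio n).pi B) =
      ∫⁻ ω in A, boxProb κ n B (V t ω) ∂μ := by
  induction n generalizing t A B with
  | zero => simp [Set.pi, boxProb]
  | succ n ih =>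
    have hsplit : A ∩ (fun ω i => V (t + i) ω) ⁻¹' (Set.Iio (n + 1)).pi B =
        (A ∩ V t ⁻¹' B 0) ∩
          (fun ω i => V (t + 1 + i) ω) ⁻¹' (Set.Iio n).pi fun i => B (i + 1) := by
      rw [pi_Iio_succ, Set.preimage_inter, ← Set.inter_assoc]
      simp only [Set.preimage_preimage, Nat.add_right_comm t 1, add_assoc t]
      rfl
    have hA' : MeasurableSet[ℱ t] (A ∩ V t ⁻¹' B 0) := hA.inter (h.adapted t (hB 0))
    rw [hsplit, ih (t + 1) (ℱ.mono t.le_succ _ hA') fun i => hB (i + 1),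
      h.setLIntegral_succ hA' (measurable_boxProb κ n fun i => hB (i + 1)),
      Set.inter_comm, ← Measure.restrict_restrict (h.measurable t (hB 0)),
      ← lintegral_indicator (h.measurable t (hB 0))]
    rfl

theorem measure_preimage_pi_Iio (h : IsMarkovChain κ μ ℱ V) (n : ℕ) {B : ℕ → Set E}
    (hB : ∀ i, MeasurableSet (B i)) :
    μ ((fun ω i => V i ω) ⁻¹' (Set.Iio n).pi B) = ∫⁻ ω, boxProb κ n B (V 0 ω) ∂μ := by
  simpa only [Set.univ_inter, zero_add, Measure.restrict_univ] using
    h.measure_inter_preimage_pi_Iio n 0 MeasurableSet.univ hB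

end IsMarkovChain

/-- The law of the trajectory of the Markov chain with transition kernel `κ`, as a function of the
starting point. -/
noncomputable def chainKernel (κ : Kernel E E) [IsMarkovKernel κ] : Kernel E (ℕ → E) :=
  (Kernel.traj (X := fun _ => E)
    (fun n => κ.comap (fun x : (Π _ : Finset.Iic n, E) => x ⟨n, by simp⟩) (measurable_pi_apply _))
    0).comap (fun x _ => x) (by fun_prop)

section chainKernel

variable (κ : Kernel E E) [IsMarkovKernel κ]

instance : IsMarkovKernel (chainKernel κ) := by unfold chainKernel; infer_instance

theorem isMarkovChain_chainKernel (x : E) :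
    IsMarkovChain κ (chainKernel κ x) (Filtration.piLE (X := fun _ => E)) (fun t p => p t) where
  adapted t := by
    rw [Filtration.piLE_eq_comap_frestrictLe]
    exact (measurable_pi_apply (X := fun _ : Finset.Iic t => E) ⟨t, by simp⟩).comp
      (comap_measurable _)
  markov t A hA B hB := by
    rw [Filtration.piLE_eq_comap_frestrictLe] at hA
    obtain ⟨A', hA', rfl⟩ := hA
    set η : (n : ℕ) → Kernel (Π _ : Finset.Iic n, E) E := fun n =>
      κ.comap (fun x : (Π _ : Finset.Iic n, E) => x ⟨n, by simp⟩) (measurable_pi_apply _)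
    have hlaw := DFunLike.congr_fun (Kernel.partialTraj_compProd_eq_map_traj (X := fun _ => E)
      (κ := η) (Nat.zero_le t) (x₀ := fun _ => x)) (A' ×ˢ B)
    rw [Measure.map_apply (by fun_prop) (hA'.prod hB), Measure.compProd_apply_prod hA' hB,
      ← Kernel.traj_map_frestrictLe_apply, setLIntegral_map hA' (Kernel.measurable_coe _ hB)
      (Preorder.measurable_frestrictLe t)] at hlaw
    exact hlaw.symm

theorem map_eval_zero_chainKernel : (chainKernel κ).map (fun p => p 0) = Kernel.id := by
  ext1 x
  have hfactor : (fun p : ℕ → E => p 0) = (fun q : (Π _ : Finset.Iic 0, E) => q ⟨0, by simp⟩) ∘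
      Preorder.frestrictLe (π := fun _ : ℕ => E) 0 := rfl
  rw [Kernel.map_apply _ (measurable_pi_apply 0), Kernel.id_apply, chainKernel, Kernel.comap_apply,
    hfactor, ← Measure.map_map (measurable_pi_apply (X := fun _ : Finset.Iic 0 => E) _)
      (Preorder.measurable_frestrictLe 0), Kernel.traj_map_frestrictLe_apply,
    Kernel.partialTraj_self, Kernel.id_apply,
    Measure.map_dirac' (measurable_pi_apply (X := fun _ : Finset.Iic 0 => E) _)]

theorem chainKernel_map_eval_zero (x : E) :
    (chainKernel κ x).map (fun p => p 0) = Measure.dirac x := by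
  rw [← Kernel.map_apply _ (measurable_pi_apply 0), map_eval_zero_chainKernel, Kernel.id_apply]

theorem chainKernel_pi_Iio (x : E) (n : ℕ) {B : ℕ → Set E} (hB : ∀ i, MeasurableSet (B i)) :
    chainKernel κ x ((Set.Iio n).pi B) = boxProb κ n B x := by
  have hbox := measurable_boxProb κ n hB
  refine ((isMarkovChain_chainKernel κ x).measure_preimage_pi_Iio n hB).trans ?_
  rw [← lintegral_map hbox (measurable_pi_apply 0), chainKernel_map_eval_zero,
    lintegral_dirac' _ hbox]

theorem chainKernel_map_shift (x : E) :
    (chainKernel κ x).map shift = (κ x).bind (chainKernel κ) := by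
  have : IsProbabilityMeasure ((chainKernel κ x).map shift) :=
    Measure.isProbabilityMeasure_map measurable_shift.aemeasurable
  refine measure_ext_of_pi_Iio fun n B hB => ?_
  set B' : ℕ → Set E := fun i => Nat.casesOn i Set.univ B
  have hB' : ∀ i, MeasurableSet (B' i) := by
    rintro (_ | i)
    exacts [MeasurableSet.univ, hB i]
  have hpre : shift ⁻¹' (Set.Iio n).pi B = (Set.Iio (n + 1)).pi B' := by
    rw [pi_Iio_succ]
    exact (Set.univ_inter _).symm
  rw [Measure.map_apply measurable_shift (measurableSet_pi_Iio n hB), hpre,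
    chainKernel_pi_Iio κ x _ hB',
    Measure.bind_apply (measurableSet_pi_Iio n hB) (chainKernel κ).aemeasurable]
  simp only [chainKernel_pi_Iio κ _ _ hB, boxProb]
  exact congrFun (Set.indicator_univ _) x

theorem chainKernel_preimage_shift (x : E) {S : Set (ℕ → E)} (hS : MeasurableSet S) :
    chainKernel κ x (shift ⁻¹' S) = ∫⁻ y, chainKernel κ y S ∂κ x := by
  rw [← Measure.map_apply measurable_shift hS, chainKernel_map_shift,
    Measure.bind_apply hS (chainKernel κ).aemeasurable]

theorem chainKernel_inter_preimage_shift (x : E) {B : Set E} (hB : MeasurableSet B)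
    {S : Set (ℕ → E)} (hS : MeasurableSet S) :
    chainKernel κ x ({p | p 0 ∈ B} ∩ shift ⁻¹' S) =
      B.indicator (fun x => ∫⁻ y, chainKernel κ y S ∂κ x) x := by
  have hjoint := congrArg (fun m => m (B ×ˢ (shift ⁻¹' S)))
    (map_prodMk_of_map_eq_dirac (measurable_pi_apply 0) (chainKernel_map_eval_zero κ x))
  rw [Measure.map_apply (by fun_prop) (hB.prod (measurable_shift hS)), Measure.prod_prod,
    Measure.dirac_apply' _ hB, chainKernel_preimage_shift κ x hS] at hjoint
  refine hjoint.trans ?_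
  by_cases hx : x ∈ B <;> simp [hx]

end chainKernel

variable {κ : Kernel E E} [IsMarkovKernel κ]

theorem IsMarkovChain.map_trajectory_eq {Ω : Type*} {mΩ : MeasurableSpace Ω} {μ : Measure Ω}
    [IsFiniteMeasure μ] {ℱ : Filtration ℕ mΩ} {V : ℕ → Ω → E} (h : IsMarkovChain κ μ ℱ V) :
    μ.map (fun ω i => V i ω) = (μ.map (V 0)).bind (chainKernel κ) := by
  have hV : Measurable fun ω i => V i ω := measurable_pi_lambda _ h.measurable
  refine measure_ext_of_pi_Iio fun n B hB => ?_
  have hbox := measurableSet_pi_Iio n hB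
  rw [Measure.map_apply hV hbox, h.measure_preimage_pi_Iio n hB,
    Measure.bind_apply hbox (chainKernel κ).aemeasurable]
  simp only [chainKernel_pi_Iio κ _ _ hB]
  rw [lintegral_map (measurable_boxProb κ n hB) (h.measurable 0)]

section stationary

variable {Γ : Measure E}

theorem measurePreserving_shift (hinv : κ.Invariant Γ) :
    MeasurePreserving shift (Γ.bind (chainKernel κ)) (Γ.bind (chainKernel κ)) := by
  refine ⟨measurable_shift, ?_⟩
  have hshift : (chainKernel κ).map shift = chainKernel κ ∘ₖ κ := by
    ext1 x
    rw [Kernel.map_apply _ measurable_shift, chainKernel_map_shift, Kernel.comp_apply]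
  rw [Measure.map_comp _ _ measurable_shift, hshift, ← Measure.comp_assoc, hinv.def]

theorem measurePreserving_eval_zero :
    MeasurePreserving (fun p : ℕ → E => p 0) (Γ.bind (chainKernel κ)) Γ := by
  refine ⟨measurable_pi_apply 0, ?_⟩
  rw [Measure.map_comp _ _ (measurable_pi_apply 0), map_eval_zero_chainKernel, Measure.id_comp]

theorem ae_chainKernel_pi_Iio_inter (hinv : κ.Invariant Γ) {A : Set (ℕ → E)}
    (hA : MeasurableSet A) (hAinv : shift ⁻¹' A = A) {c : ℝ≥0∞}
    (hc : (fun x => chainKernel κ x A) =ᵐ[Γ] fun _ => c) (n : ℕ) {B : ℕ → Set E}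
    (hB : ∀ i, MeasurableSet (B i)) :
    ∀ᵐ x ∂Γ, chainKernel κ x ((Set.Iio n).pi B ∩ A) =
      c * chainKernel κ x ((Set.Iio n).pi B) := by
  induction n generalizing B with
  | zero =>
    filter_upwards [hc] with x hx
    simpa [Set.pi] using hx
  | succ n ih =>
    have htail := ih fun i => hB (i + 1)
    rw [← hinv.def] at htail
    filter_upwards [Measure.ae_ae_of_ae_bind κ.aemeasurable htail] with x hx
    have hbox := measurableSet_pi_Iio n fun i => hB (i + 1)
    have hsplit : (Set.Iio (n + 1)).pi B ∩ A =
        {p | p 0 ∈ B 0} ∩ shift ⁻¹' ((Set.Iio n).pi (fun i => B (i + 1)) ∩ A) := by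
      rw [pi_Iio_succ, Set.preimage_inter, hAinv, Set.inter_assoc]
    rw [hsplit, pi_Iio_succ, chainKernel_inter_preimage_shift κ x (hB 0) (hbox.inter hA),
      chainKernel_inter_preimage_shift κ x (hB 0) hbox]
    by_cases hxB : x ∈ B 0
    · rw [Set.indicator_of_mem hxB, Set.indicator_of_mem hxB, lintegral_congr_ae hx,
        lintegral_const_mul _ (Kernel.measurable_coe _ hbox)]
    · simp only [Set.indicator_of_notMem hxB, mul_zero]

/-- The Liouville property of the kernel `κ`: its bounded harmonic functions are `Γ`-almost
everywhere constant. It suffices to consider functions with values in `[0, 1]`. -/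
def IsLiouville (κ : Kernel E E) (Γ : Measure E) : Prop :=
  ∀ h : E → ℝ≥0∞, Measurable h → (∀ x, h x ≤ 1) → (∀ x, ∫⁻ y, h y ∂κ x = h x) →
    ∃ c, h =ᵐ[Γ] fun _ => c

variable [IsProbabilityMeasure Γ]

theorem IsLiouville.exists_restrict_eq_smul (hΓ : IsLiouville κ Γ) (hinv : κ.Invariant Γ)
    {A : Set (ℕ → E)} (hA : MeasurableSet A) (hAinv : shift ⁻¹' A = A) :
    ∃ c : ℝ≥0∞, (Γ.bind (chainKernel κ)).restrict A = c • Γ.bind (chainKernel κ) := by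
  have hharm (x : E) : ∫⁻ y, chainKernel κ y A ∂κ x = chainKernel κ x A := by
    rw [← chainKernel_preimage_shift κ x hA, hAinv]
  obtain ⟨c, hc⟩ := hΓ _ (Kernel.measurable_coe _ hA) (fun _ => prob_le_one) hharm
  refine ⟨c, measure_ext_of_pi_Iio fun n B hB => ?_⟩
  have hbox := measurableSet_pi_Iio n hB
  rw [Measure.restrict_apply hbox, Measure.smul_apply, smul_eq_mul,
    Measure.bind_apply (hbox.inter hA) (chainKernel κ).aemeasurable,
    Measure.bind_apply hbox (chainKernel κ).aemeasurable,
    lintegral_congr_ae (ae_chainKernel_pi_Iio_inter hinv hA hAinv hc n hB),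
    lintegral_const_mul _ (Kernel.measurable_coe _ hbox)]

theorem IsLiouville.ergodic_shift (hΓ : IsLiouville κ Γ) (hinv : κ.Invariant Γ) :
    Ergodic shift (Γ.bind (chainKernel κ)) := by
  refine ⟨measurePreserving_shift hinv, ⟨fun A hA hAinv => ?_⟩⟩
  obtain ⟨c, hc⟩ := hΓ.exists_restrict_eq_smul hinv hA hAinv
  have hAc : Γ.bind (chainKernel κ) A = c := by
    simpa using congrArg (fun M => M Set.univ) hc
  have hsq : Γ.bind (chainKernel κ) (A ∩ A) =
      Γ.bind (chainKernel κ) A * Γ.bind (chainKernel κ) A := by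
    rw [← Measure.restrict_apply hA, hc, Measure.smul_apply, smul_eq_mul, hAc]
  rw [eventuallyConst_set', ae_eq_empty, ae_eq_univ, prob_compl_eq_zero_iff hA]
  exact measure_eq_zero_or_one_of_indepSet_self ((indepSet_iff_measure_inter_eq_mul hA hA _).2 hsq)

/-- Absolute continuity with respect to the stationary law transfers the pointwise ergodic theorem
from the stationary chain to `V`. -/
theorem IsMarkovChain.ae_tendsto_average (hΓ : IsLiouville κ Γ) (hinv : κ.Invariant Γ)
    {Ω : Type*} {mΩ : MeasurableSpace Ω} {μ : Measure Ω} [IsFiniteMeasure μ] {ℱ : Filtration ℕ mΩ}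
    {V : ℕ → Ω → E} (h : IsMarkovChain κ μ ℱ V) (hac : μ.map (V 0) ≪ Γ) {f : E → ℝ}
    (hf : Integrable f Γ) :
    ∀ᵐ ω ∂μ, Tendsto (fun T : ℕ => (1 / (T : ℝ)) * ∑ t ∈ Finset.range T, f (V t ω)) atTop
      (𝓝 (∫ x, f x ∂Γ)) := by
  have heval : MeasurePreserving (fun p : ℕ → E => p 0) (Γ.bind (chainKernel κ)) Γ :=
    measurePreserving_eval_zero
  have hstat := ae_tendsto_birkhoffAverage (hΓ.ergodic_shift hinv)
    (f := fun p : ℕ → E => f (p 0)) (heval.integrable_comp_of_integrable hf)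
  have integral_eval_zero : ∫ p, f (p 0) ∂(Γ.bind (chainKernel κ)) = ∫ x, f x ∂Γ :=
    heval.hasLaw.integral_comp hf.aestronglyMeasurable
  have htraj : μ.map (fun ω i => V i ω) ≪ Γ.bind (chainKernel κ) := by
    rw [h.map_trajectory_eq]
    exact hac.comp_right _
  filter_upwards [ae_of_ae_map (measurable_pi_lambda _ h.measurable).aemeasurable
    (htraj.ae_le hstat)] with ω hω
  rw [integral_eval_zero] at hω
  refine hω.congr fun T => ?_
  simp [birkhoffAverage, birkhoffSum, iterate_shift_apply]

end stationary

end MarkovChain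

section Product

variable {α β γ δ : Type*} [MeasurableSpace α] [MeasurableSpace β] [MeasurableSpace γ]
  [MeasurableSpace δ]

theorem prod_bind_parallelComp (μ : Measure α) (ν : Measure β) [SFinite μ] [SFinite ν]
    (κ : Kernel α γ) (η : Kernel β δ) [IsSFiniteKernel κ] [IsSFiniteKernel η] :
    (μ.prod ν).bind (κ ∥ₖ η) = (μ.bind κ).prod (ν.bind η) := by
  rw [Measure.prod_comp_right, Measure.prod_comp_left, Measure.comp_assoc,
    Kernel.parallelComp_comp_parallelComp, Kernel.id_comp, Kernel.comp_id]

theorem bind_prod_const (μ : Measure α) (κ : Kernel α β) [IsSFiniteKernel κ] (ν : Measure γ)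
    [SFinite ν] : μ.bind (κ ×ₖ Kernel.const α ν) = (μ.bind κ).prod ν := by
  ext s hs
  rw [Measure.bind_apply hs (Kernel.aemeasurable _), Measure.prod_apply hs,
    Measure.lintegral_bind (Kernel.aemeasurable _) (measurable_measure_prodMk_left hs).aemeasurable]
  simp only [Kernel.prod_apply, Kernel.const_apply, Measure.prod_apply hs]

variable {ι : Type*} [Fintype ι]

theorem pi_bind_prodKernel (μ : ι → Measure α) [∀ i, IsProbabilityMeasure (μ i)]
    (κ : ι → Kernel α β) [∀ i, IsMarkovKernel (κ i)] :
    (Measure.pi μ).bind (prodKernel fun i => (κ i).comap (fun x => x i) (measurable_pi_apply i)) =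
      Measure.pi fun i => (μ i).bind (κ i) := by
  refine (Measure.pi_eq fun s hs => ?_).symm
  have measurable_apply (i : ι) : Measurable fun x => κ i x (s i) :=
    Kernel.measurable_coe _ (hs i)
  calc (Measure.pi μ).bind (prodKernel fun i => (κ i).comap (fun x => x i) _) (Set.univ.pi s)
      = ∫⁻ y, ∏ i, κ i (y i) (s i) ∂Measure.pi μ := by
        rw [Measure.bind_apply (MeasurableSet.univ_pi hs) (Kernel.aemeasurable _)]
        exact lintegral_congr fun y => Measure.pi_pi _ _
    _ = ∏ i, ∫⁻ y, κ i (y i) (s i) ∂Measure.pi μ :=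
        lintegral_prod_eq_prod_lintegral_of_indepFun Finset.univ
          (fun i (y : ι → α) => κ i (y i) (s i))
          (iIndepFun_pi fun i => (measurable_apply i).aemeasurable)
          fun i => (measurable_apply i).comp (measurable_pi_apply i)
    _ = ∏ i, (μ i).bind (κ i) (s i) := by
        refine Finset.prod_congr rfl fun i _ => ?_
        rw [Measure.bind_apply (hs i) (Kernel.aemeasurable _),
          (measurePreserving_eval μ i).lintegral_comp (measurable_apply i)]

theorem prodKernel_map_eval (κ : ι → Kernel α β) [∀ i, IsMarkovKernel (κ i)] (i : ι) :
    (prodKernel κ).map (fun y => y i) = κ i := by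
  ext1 x
  rw [Kernel.map_apply _ (measurable_pi_apply i)]
  exact (measurePreserving_eval (fun i => κ i x) i).map_eq

theorem pi_map_eval_pair {β : ι → Type*} [∀ i, MeasurableSpace (β i)] (μ : ∀ i, Measure (β i))
    [∀ i, IsProbabilityMeasure (μ i)] {i j : ι} (hij : i ≠ j) :
    (Measure.pi μ).map (fun y => (y i, y j)) = (μ i).prod (μ j) := by
  have indep := (iIndepFun_pi (μ := μ) (X := fun _ => id) fun _ => aemeasurable_id).indepFun hij
  have map_pair := (indepFun_iff_map_prod_eq_prod_map_map (measurable_pi_apply i).aemeasurable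
    (measurable_pi_apply j).aemeasurable).1 indep
  rwa [(measurePreserving_eval μ i).map_eq, (measurePreserving_eval μ j).map_eq] at map_pair

theorem pi_dirac (x : ι → α) : Measure.pi (fun i => Measure.dirac (x i)) = Measure.dirac x := by
  classical
  refine Measure.pi_eq fun s hs => ?_
  simp only [Measure.dirac_apply' _ (MeasurableSet.univ_pi hs), Measure.dirac_apply' _ (hs _),
    Set.indicator_apply, Pi.one_apply, Set.mem_univ_pi, Finset.prod_boole, Finset.mem_univ,
    true_imp_iff]

theorem pi_map_extend_const (p : ι → Prop) [DecidablePred p] (m : ι → Measure α)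
    [∀ i, IsProbabilityMeasure (m i)] (c : α) :
    (Measure.pi fun i : {i // p i} => m i).map (fun d i => if h : p i then d ⟨i, h⟩ else c) =
      Measure.pi fun i => if p i then m i else Measure.dirac c := by
  have (i : ι) : IsProbabilityMeasure (if p i then m i else Measure.dirac c) := by
    split_ifs <;> infer_instance
  have hsub : (Measure.pi fun i : {i // p i} => if p i then m i else Measure.dirac c) =
      Measure.pi fun i : {i // p i} => m i := by
    congr! with i
    rw [if_pos i.2]
  have hcompl : (Measure.pi fun i : {i // ¬p i} => if p i then m i else Measure.dirac c) =
      Measure.dirac fun _ => c := by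
    rw [← pi_dirac]
    congr! with i
    rw [if_neg i.2]
  rw [← (measurePreserving_piEquivPiSubtypeProd
    (fun i => if p i then m i else Measure.dirac c) p).symm.map_eq, hsub, hcompl,
    Measure.prod_dirac, Measure.map_map (MeasurableEquiv.measurable _) (by fun_prop)]
  rfl

end Product

section Update

open Function

variable {ι : Type*} [DecidableEq ι]

section

variable {β : ι → Type*} [∀ i, MeasurableSpace (β i)]

instance isProbabilityMeasure_update (μ : ∀ i, Measure (β i)) [∀ i, IsProbabilityMeasure (μ i)]
    (j : ι) (ν : Measure (β j)) [IsProbabilityMeasure ν] (i : ι) :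
    IsProbabilityMeasure (update μ j ν i) := by
  obtain rfl | h := eq_or_ne i j
  · simpa only [update_self]
  · rw [update_of_ne h]
    infer_instance

variable [Fintype ι]

theorem pi_prod_map_update (μ : ∀ i, Measure (β i)) [∀ i, IsProbabilityMeasure (μ i)] (j : ι)
    (ν : Measure (β j)) [IsProbabilityMeasure ν] :
    ((Measure.pi μ).prod ν).map (fun p => update p.1 j p.2) = Measure.pi (update μ j ν) := by
  refine (Measure.pi_eq fun s hs => ?_).symm
  have preimage_box : (fun p : (∀ i, β i) × β j => update p.1 j p.2) ⁻¹' Set.univ.pi s =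
      Set.univ.pi (update s j Set.univ) ×ˢ s j := by
    ext p
    simp only [Set.mem_preimage, Set.mem_univ_pi, Set.mem_prod,
      forall_update_iff p.1 (fun i y => y ∈ s i), forall_update_iff s (fun i t => p.1 i ∈ t),
      Set.mem_univ, true_and]
    exact and_comm
  rw [Measure.map_apply measurable_update' (MeasurableSet.univ_pi hs), preimage_box,
    Measure.prod_prod, Measure.pi_pi, ← Finset.prod_erase_mul _ _ (Finset.mem_univ j),
    ← Finset.prod_erase_mul _ _ (Finset.mem_univ j), update_self, update_self, measure_univ,
    mul_one]
  congr 1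
  refine Finset.prod_congr rfl fun i hi => ?_
  rw [update_of_ne (Finset.ne_of_mem_erase hi), update_of_ne (Finset.ne_of_mem_erase hi)]

end

variable {β : Type*} [MeasurableSpace β]

theorem measurable_update_update (j k : ι) :
    Measurable fun p : (ι → β) × β × β => update (update p.1 j p.2.1) k p.2.2 := by
  have measurable_update_fst : Measurable fun p : (ι → β) × β × β => update p.1 j p.2.1 :=
    measurable_update'.comp (measurable_fst.prodMk (measurable_fst.comp measurable_snd))
  exact measurable_update'.comp
    (measurable_update_fst.prodMk (measurable_snd.comp measurable_snd))

/-- Resampling the coordinates `j` and `k` by a kernel that reads only these coordinates. -/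
noncomputable def liftPair (j k : ι) (τ : Kernel (β × β) (β × β)) : Kernel (ι → β) (ι → β) :=
  (Kernel.id ×ₖ τ.comap (fun y => (y j, y k)) (by fun_prop)).map
    fun p => update (update p.1 j p.2.1) k p.2.2

theorem liftPair_apply (j k : ι) (τ : Kernel (β × β) (β × β)) [IsMarkovKernel τ] (y : ι → β) :
    liftPair j k τ y = (τ (y j, y k)).map fun q => update (update y j q.1) k q.2 := by
  rw [liftPair, Kernel.map_apply _ (measurable_update_update j k), Kernel.prod_apply,
    Kernel.id_apply, Kernel.comap_apply, Measure.dirac_prod,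
    Measure.map_map (measurable_update_update j k) measurable_prodMk_left]
  rfl

instance (j k : ι) (τ : Kernel (β × β) (β × β)) [IsMarkovKernel τ] :
    IsMarkovKernel (liftPair j k τ) :=
  Kernel.IsMarkovKernel.map _ (measurable_update_update j k)

variable [Fintype ι]

theorem pi_prod_prod_map_update_update (μ : ι → Measure β) [∀ i, IsProbabilityMeasure (μ i)]
    (j k : ι) (a b : Measure β) [IsProbabilityMeasure a] [IsProbabilityMeasure b] :
    ((Measure.pi μ).prod (a.prod b)).map (fun p => update (update p.1 j p.2.1) k p.2.2) =
      Measure.pi (update (update μ j a) k b) := by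
  rw [← pi_prod_map_update, ← pi_prod_map_update, ← Measure.map_id (μ := b),
    Measure.map_prod_map _ _ measurable_update' measurable_id, Measure.map_id,
    ← Measure.prodAssoc_prod, Measure.map_map (by fun_prop) (by fun_prop),
    Measure.map_map measurable_update' (by fun_prop)]
  rfl

theorem pi_bind_liftPair (μ : ι → Measure β) [∀ i, IsProbabilityMeasure (μ i)] {j k : ι}
    (hjk : j ≠ k) (τ : Kernel (β × β) (β × β)) [IsMarkovKernel τ] {a b : Measure β}
    [IsProbabilityMeasure a] [IsProbabilityMeasure b]
    (hτ : ((μ j).prod (μ k)).bind τ = a.prod b) :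
    (Measure.pi μ).bind (liftPair j k τ) = Measure.pi (update (update μ j a) k b) := by
  set u := fun p : (ι → β) × β × β => update (update p.1 j p.2.1) k p.2.2 with hu_def
  have hu : Measurable u := measurable_update_update j k
  have liftPair_comp : liftPair j k τ ∘ₖ Kernel.deterministic u hu = (Kernel.id ∥ₖ τ).map u := by
    ext1 ⟨x, q⟩
    rw [Kernel.comp_deterministic_eq_comap, Kernel.comap_apply, liftPair_apply,
      Kernel.map_apply _ hu, Kernel.parallelComp_apply, Kernel.id_apply, Measure.dirac_prod,
      Measure.map_map hu measurable_prodMk_left]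
    simp only [hu_def, update_self, update_of_ne hjk, update_comm hjk.symm, update_idem,
      Function.comp_def]
  calc (Measure.pi μ).bind (liftPair j k τ)
      = (((Measure.pi μ).prod ((μ j).prod (μ k))).map u).bind (liftPair j k τ) := by
        rw [pi_prod_prod_map_update_update, update_eq_self, update_eq_self]
    _ = (((Measure.pi μ).prod ((μ j).prod (μ k))).bind (Kernel.id ∥ₖ τ)).map u := by
        rw [← Measure.deterministic_comp_eq_map hu, Measure.comp_assoc, liftPair_comp,
          Measure.map_comp _ _ hu]
    _ = ((Measure.pi μ).prod (a.prod b)).map u := by rw [← Measure.prod_comp_right, hτ]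
    _ = Measure.pi (update (update μ j a) k b) := pi_prod_prod_map_update_update μ j k a b

end Update

theorem pi_absolutelyContinuous_pi {ι : Type*} {β : ι → Type*} [Fintype ι]
    [∀ i, MeasurableSpace (β i)] {μ ν : ∀ i, Measure (β i)} [∀ i, IsProbabilityMeasure (μ i)]
    [∀ i, IsProbabilityMeasure (ν i)] (h : ∀ i, μ i ≪ ν i) : Measure.pi μ ≪ Measure.pi ν := by
  classical
  have (s : Finset ι) (i : ι) : IsProbabilityMeasure (s.piecewise ν μ i) := by
    by_cases hi : i ∈ s
    · rw [Finset.piecewise_eq_of_mem _ _ _ hi]; infer_instance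
    · rw [Finset.piecewise_eq_of_notMem _ _ _ hi]; infer_instance
  suffices ∀ s : Finset ι, Measure.pi μ ≪ Measure.pi (s.piecewise ν μ) by
    simpa using this Finset.univ
  intro s
  induction s using Finset.induction_on with
  | empty => rw [Finset.piecewise_empty]
  | insert j s hj ih =>
    refine ih.trans ?_
    have pi_eq : Measure.pi (s.piecewise ν μ) = ((Measure.pi (s.piecewise ν μ)).prod (μ j)).map
        fun p => Function.update p.1 j p.2 := by
      rw [pi_prod_map_update, ← Finset.piecewise_eq_of_notMem s ν μ hj, Function.update_eq_self]
    rw [Finset.piecewise_insert, ← pi_prod_map_update]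
    exact pi_eq.absolutelyContinuous.trans
      ((Measure.AbsolutelyContinuous.rfl.prod (h j)).map measurable_update')

section Metropolis

variable {α : Type*} [MeasurableSpace α]

theorem measurePreserving_withDensity {μ : Measure α} {σ : α → α} (hσ : MeasurePreserving σ μ μ)
    {f : α → ℝ≥0∞} (hf : Measurable f) (hfσ : ∀ z, f (σ z) = f z) :
    MeasurePreserving σ (μ.withDensity f) (μ.withDensity f) := by
  refine ⟨hσ.measurable, Measure.ext fun s hs => ?_⟩
  rw [Measure.map_apply hσ.measurable hs, withDensity_apply _ (hσ.measurable hs),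
    withDensity_apply _ hs, ← hσ.setLIntegral_comp_preimage hs hf]
  simp only [hfσ]

theorem lintegral_accept_reject {ν : Measure α} {a : α → ℝ≥0∞} (ha : Measurable a)
    (ha_le : ∀ z, a z ≤ 1) {σ : α → α}
    (hσ : MeasurePreserving σ (ν.withDensity a) (ν.withDensity a)) {g : α → ℝ≥0∞}
    (hg : Measurable g) :
    ∫⁻ z, (a z * g (σ z) + (1 - a z) * g z) ∂ν = ∫⁻ z, g z ∂ν := by
  have accepted_eq : ∫⁻ z, a z * g (σ z) ∂ν = ∫⁻ z, a z * g z ∂ν :=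
    calc ∫⁻ z, a z * g (σ z) ∂ν
        = ∫⁻ z, g (σ z) ∂ν.withDensity a :=
          (lintegral_withDensity_eq_lintegral_mul ν ha (hg.comp hσ.measurable)).symm
      _ = ∫⁻ z, g z ∂ν.withDensity a := hσ.lintegral_comp hg
      _ = ∫⁻ z, a z * g z ∂ν := lintegral_withDensity_eq_lintegral_mul ν ha hg
  have measurable_accepted : Measurable fun z => a z * g (σ z) :=
    ha.mul (hg.comp hσ.measurable)
  rw [lintegral_add_left measurable_accepted, accepted_eq,
    ← lintegral_add_left (f := fun z => a z * g z) (ha.mul hg)]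
  refine lintegral_congr fun z => ?_
  rw [← add_mul, add_tsub_cancel_of_le (ha_le z), one_mul]

theorem lintegral_unitInterval_ite_lt (a : unitInterval) (A B : ℝ≥0∞) :
    ∫⁻ u : unitInterval, (if u < a then A else B) =
      ENNReal.ofReal a * A + (1 - ENNReal.ofReal a) * B := by
  change ∫⁻ u : unitInterval, (Set.Iio a).piecewise (fun _ => A) (fun _ => B) u = _
  rw [lintegral_piecewise measurableSet_Iio, setLIntegral_const, setLIntegral_const,
    prob_compl_eq_one_sub measurableSet_Iio, unitInterval.volume_Iio, mul_comm A, mul_comm B]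

end Metropolis

variable {𝓧 : Type*} [MeasurableSpace 𝓧]

theorem pathKernel_map_zero (K : ℕ) (P : Fin K → Kernel 𝓧 𝓧) [∀ k, IsMarkovKernel (P k)] :
    (pathKernel K P).map (fun p => p 0) = Kernel.id := by
  cases K with
  | zero =>
    rw [pathKernel, Kernel.deterministic_map _ (measurable_pi_apply 0)]
    rfl
  | succ K =>
    rw [pathKernel, ← Kernel.map_comp_right _ (measurable_cons K) (measurable_pi_apply 0)]
    change (_ : Kernel 𝓧 (𝓧 × (Fin (K + 1) → 𝓧))).map Prod.fst = _
    rw [← Kernel.fst_eq, Kernel.fst_prod]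

theorem revPathKernel_map_last (K : ℕ) (Q : Fin K → Kernel 𝓧 𝓧) [∀ k, IsMarkovKernel (Q k)] :
    (revPathKernel K Q).map (fun p => p (Fin.last K)) = Kernel.id := by
  rw [revPathKernel, ← Kernel.map_comp_right _ (by fun_prop) (measurable_pi_apply _),
    ← pathKernel_map_zero K fun k => Q k.rev]
  congr 1
  ext p
  simp

/-- The starting points of a forward path and a backward path. The swap move exchanges the roles
of the two paths, so it proposes `startPair z.swap` as new states if the paths are `z`. -/
def startPair {K : ℕ} (z : Path K 𝓧 × Path K 𝓧) : 𝓧 × 𝓧 := (z.1 0, z.2 (Fin.last K))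

theorem measurable_startPair {K : ℕ} : Measurable (startPair (K := K) (𝓧 := 𝓧)) := by
  unfold startPair
  fun_prop

namespace Data

variable {N K : ℕ} (S : Data N K 𝓧) (j : Fin N)

section Accept

theorem measurable_work : Measurable (S.work j) :=
  measurable_const.sub (Measure.measurable_rnDeriv _ _).ennreal_toReal.log

theorem measurable_accept : Measurable fun z : Path K 𝓧 × Path K 𝓧 => S.accept j z.1 z.2 :=
  (measurable_const.min (((S.measurable_work j).comp measurable_snd).sub
    ((S.measurable_work j).comp measurable_fst))).exp

theorem accept_pos (x x' : Path K 𝓧) : 0 < S.accept j x x' := Real.exp_pos _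

theorem accept_le_one (x x' : Path K 𝓧) : S.accept j x x' ≤ 1 :=
  Real.exp_le_one_iff.2 (min_le_left _ _)

theorem measurableSet_accepted : MeasurableSet {d : Draw K 𝓧 | S.Accepted j d} := by
  have measurable_uniform : Measurable fun d : Draw K 𝓧 => (d.2.2 : ℝ) :=
    measurable_subtype_coe.comp (measurable_snd.comp measurable_snd)
  have measurable_paths : Measurable fun d : Draw K 𝓧 => (d.1, d.2.1) := by fun_prop
  have measurable_accept_paths := (S.measurable_accept j).comp measurable_paths
  exact measurableSet_lt measurable_uniform measurable_accept_paths

end Accept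

section PairDraw

/-- The draw for the swap `j`, as a function of the states of the two chains. -/
noncomputable def pairDraw : Kernel (𝓧 × 𝓧) (Draw K 𝓧) :=
  pathKernel K (S.fwd j) ∥ₖ
    (revPathKernel K (S.bwd j) ×ₖ Kernel.const 𝓧 (volume : Measure unitInterval))

instance : IsMarkovKernel (S.pairDraw j) := by
  unfold pairDraw
  infer_instance

theorem pairDraw_apply (q : 𝓧 × 𝓧) :
    S.pairDraw j q =
      (pathKernel K (S.fwd j) q.1).prod ((revPathKernel K (S.bwd j) q.2).prod volume) := by
  rw [pairDraw, Kernel.parallelComp_apply, Kernel.prod_apply, Kernel.const_apply]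

theorem drawKernel_apply (y : State N 𝓧) :
    S.drawKernel j y = S.pairDraw j (y j.castSucc, y j.succ) := by
  rw [pairDraw_apply, drawKernel, Kernel.prod_apply, Kernel.comap_apply, Kernel.prod_apply,
    Kernel.comap_apply, Kernel.const_apply]

theorem prod_bind_pairDraw (μ ν : Measure 𝓧) [SFinite μ] [SFinite ν] :
    (μ.prod ν).bind (S.pairDraw j) =
      (μ.bind (pathKernel K (S.fwd j))).prod
        ((ν.bind (revPathKernel K (S.bwd j))).prod volume) := by
  rw [pairDraw, prod_bind_parallelComp, bind_prod_const]

theorem pairDraw_map_startPair (q : 𝓧 × 𝓧) :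
    (S.pairDraw j q).map (fun d => startPair (d.1, d.2.1)) = Measure.dirac q := by
  have startPair_eq : (fun d : Draw K 𝓧 => startPair (d.1, d.2.1)) =
      Prod.map (fun p => p 0) ((fun p => p (Fin.last K)) ∘ Prod.fst) := rfl
  rw [startPair_eq, pairDraw_apply, ← Measure.map_prod_map _ _ (by fun_prop) (by fun_prop),
    ← Measure.map_map (by fun_prop) (by fun_prop), Measure.map_fst_prod, measure_univ, one_smul,
    ← Kernel.map_apply _ (by fun_prop), ← Kernel.map_apply _ (by fun_prop), pathKernel_map_zero,
    revPathKernel_map_last, Kernel.id_apply, Kernel.id_apply, Measure.dirac_prod_dirac]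

end PairDraw

section PairKernel

open Classical in
/-- The states of the two chains after the swap `j`, if they are `q` before it. -/
noncomputable def swapPair (d : Draw K 𝓧) (q : 𝓧 × 𝓧) : 𝓧 × 𝓧 :=
  if S.Accepted j d then startPair (d.2.1, d.1) else q

theorem measurable_swapPair : Measurable fun p : (𝓧 × 𝓧) × Draw K 𝓧 => S.swapPair j p.2 p.1 :=
  Measurable.ite (measurable_snd (S.measurableSet_accepted j))
    (measurable_startPair.comp (by fun_prop)) measurable_fst

theorem lintegral_swapPair (P Q : Measure (Path K 𝓧)) [SFinite P] [SFinite Q]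
    {s : Path K 𝓧 × Path K 𝓧 → 𝓧 × 𝓧} (hs : Measurable s) {g : 𝓧 × 𝓧 → ℝ≥0∞}
    (hg : Measurable g) :
    ∫⁻ d, g (S.swapPair j d (s (d.1, d.2.1))) ∂P.prod (Q.prod volume) =
      ∫⁻ z, (ENNReal.ofReal (S.accept j z.1 z.2) * g (startPair z.swap) +
        (1 - ENNReal.ofReal (S.accept j z.1 z.2)) * g (s z)) ∂P.prod Q := by
  have measurable_integrand :
      Measurable fun d : Draw K 𝓧 => g (S.swapPair j d (s (d.1, d.2.1))) :=
    hg.comp ((S.measurable_swapPair j).comp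
      ((hs.comp (by fun_prop : Measurable fun d : Draw K 𝓧 => (d.1, d.2.1))).prodMk measurable_id))
  rw [← Measure.prodAssoc_prod, lintegral_map measurable_integrand (MeasurableEquiv.measurable _),
    lintegral_prod]
  swap
  · exact (measurable_integrand.comp (MeasurableEquiv.measurable _)).aemeasurable
  refine lintegral_congr fun z => ?_
  rw [← lintegral_unitInterval_ite_lt
    ⟨S.accept j z.1 z.2, (S.accept_pos j _ _).le, S.accept_le_one j _ _⟩]
  classical exact lintegral_congr fun u => apply_ite g _ _ _

/-- The swap `j`, as a kernel on the states of the two chains. -/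
noncomputable def pairKernel : Kernel (𝓧 × 𝓧) (𝓧 × 𝓧) :=
  (Kernel.id ×ₖ S.pairDraw j).map fun p => S.swapPair j p.2 p.1

instance : IsMarkovKernel (S.pairKernel j) :=
  Kernel.IsMarkovKernel.map _ (S.measurable_swapPair j)

theorem pairKernel_apply (q : 𝓧 × 𝓧) :
    S.pairKernel j q = (S.pairDraw j q).map fun d => S.swapPair j d q := by
  rw [pairKernel, Kernel.map_apply _ (S.measurable_swapPair j), Kernel.prod_apply, Kernel.id_apply,
    Measure.dirac_prod, Measure.map_map (S.measurable_swapPair j) measurable_prodMk_left]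
  rfl

theorem measurable_swapPair_startPair :
    Measurable fun d : Draw K 𝓧 => S.swapPair j d (startPair (d.1, d.2.1)) :=
  (S.measurable_swapPair j).comp ((measurable_startPair.comp (by fun_prop)).prodMk measurable_id)

theorem pairKernel_eq_map_startPair :
    S.pairKernel j = (S.pairDraw j).map fun d => S.swapPair j d (startPair (d.1, d.2.1)) := by
  have measurable_start : Measurable fun d : Draw K 𝓧 => startPair (d.1, d.2.1) :=
    measurable_startPair.comp (by fun_prop)
  ext1 q
  rw [pairKernel, Kernel.map_apply _ (S.measurable_swapPair j), Kernel.prod_apply, Kernel.id_apply,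
    ← map_prodMk_of_map_eq_dirac measurable_start (S.pairDraw_map_startPair j q),
    Measure.map_map (S.measurable_swapPair j) (measurable_start.prodMk measurable_id'),
    Kernel.map_apply _ (S.measurable_swapPair_startPair j)]
  rfl

theorem measurable_startPair_swap :
    Measurable fun z : Path K 𝓧 × Path K 𝓧 => startPair z.swap :=
  measurable_startPair.comp measurable_swap

/-- The kernel that carries out the swap `j` regardless of the acceptance probability. -/
noncomputable def forcedKernel : Kernel (𝓧 × 𝓧) (𝓧 × 𝓧) :=
  (pathKernel K (S.fwd j) ∥ₖ revPathKernel K (S.bwd j)).map fun z => startPair z.swap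

instance : IsMarkovKernel (S.forcedKernel j) :=
  Kernel.IsMarkovKernel.map _ measurable_startPair_swap

theorem prod_bind_forcedKernel (μ ν : Measure 𝓧) [SFinite μ] [SFinite ν] :
    (μ.prod ν).bind (S.forcedKernel j) =
      ((ν.bind (revPathKernel K (S.bwd j))).map fun p => p 0).prod
        ((μ.bind (pathKernel K (S.fwd j))).map fun p => p (Fin.last K)) := by
  rw [forcedKernel, ← Measure.map_comp _ _ measurable_startPair_swap, prod_bind_parallelComp,
    ← Measure.prod_swap, Measure.map_map measurable_startPair_swap measurable_swap,
    Measure.map_prod_map _ _ (measurable_pi_apply _) (measurable_pi_apply _)]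
  rfl

theorem forcedKernel_absolutelyContinuous_pairKernel (q : 𝓧 × 𝓧) :
    S.forcedKernel j q ≪ S.pairKernel j q := by
  refine Measure.AbsolutelyContinuous.mk fun C hC hC_null => ?_
  set g : 𝓧 × 𝓧 → ℝ≥0∞ := C.indicator 1
  have hg : Measurable g := measurable_one.indicator hC
  have measurable_swapPair_left : Measurable fun d : Draw K 𝓧 => S.swapPair j d q :=
    (S.measurable_swapPair j).comp measurable_prodMk_left
  have lintegral_eq_zero : ∫⁻ z, (ENNReal.ofReal (S.accept j z.1 z.2) * g (startPair z.swap) +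
      (1 - ENNReal.ofReal (S.accept j z.1 z.2)) * g q)
        ∂(pathKernel K (S.fwd j) q.1).prod (revPathKernel K (S.bwd j) q.2) = 0 := by
    rw [← S.lintegral_swapPair j _ _ measurable_const hg, ← pairDraw_apply,
      ← lintegral_map hg measurable_swapPair_left, ← pairKernel_apply,
      lintegral_indicator_one hC, hC_null]
  have measurable_integrand : Measurable fun z : Path K 𝓧 × Path K 𝓧 =>
      ENNReal.ofReal (S.accept j z.1 z.2) * g (startPair z.swap) +
        (1 - ENNReal.ofReal (S.accept j z.1 z.2)) * g q :=
    ((S.measurable_accept j).ennreal_ofReal.mul (hg.comp measurable_startPair_swap)).add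
      ((measurable_const.sub (S.measurable_accept j).ennreal_ofReal).mul_const _)
  rw [forcedKernel, Kernel.map_apply' _ measurable_startPair_swap _ hC, Kernel.parallelComp_apply,
    measure_eq_zero_iff_ae_notMem]
  filter_upwards [(lintegral_eq_zero_iff measurable_integrand).1 lintegral_eq_zero] with z hz hzC
  have accepted_eq_zero := (add_eq_zero.1 hz).1
  have g_eq_one : g (startPair z.swap) = 1 := Set.indicator_of_mem (Set.mem_preimage.1 hzC) _
  rw [g_eq_one, mul_one] at accepted_eq_zero
  exact (ENNReal.ofReal_pos.2 (S.accept_pos j z.1 z.2)).ne' accepted_eq_zero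

end PairKernel

end Data

namespace Data

variable {N K : ℕ} {S : Data N K 𝓧}

section Invariance

theorem Valid.isProbabilityMeasure_π (hS : S.Valid) (n : Fin (N + 1)) :
    IsProbabilityMeasure (S.π n) := by
  have : NeZero S.base := ⟨hS.base_ne_zero⟩
  exact isProbabilityMeasure_tilted (hS.integrable_exp n)

theorem Valid.isProbabilityMeasure_fwdLaw (hS : S.Valid) (j : Fin N) :
    IsProbabilityMeasure (S.fwdLaw j) := by
  have := hS.isProbabilityMeasure_π j.castSucc
  unfold fwdLaw
  infer_instance

theorem Valid.isProbabilityMeasure_bwdLaw (hS : S.Valid) (j : Fin N) :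
    IsProbabilityMeasure (S.bwdLaw j) := by
  have := hS.isProbabilityMeasure_π j.succ
  unfold bwdLaw
  infer_instance

theorem fwdLaw_map_zero (S : Data N K 𝓧) (j : Fin N) :
    (S.fwdLaw j).map (fun p => p 0) = S.π j.castSucc := by
  rw [fwdLaw, Measure.map_comp _ _ (measurable_pi_apply 0), pathKernel_map_zero, Measure.id_comp]

theorem bwdLaw_map_last (S : Data N K 𝓧) (j : Fin N) :
    (S.bwdLaw j).map (fun p => p (Fin.last K)) = S.π j.succ := by
  rw [bwdLaw, Measure.map_comp _ _ (measurable_pi_apply _), revPathKernel_map_last,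
    Measure.id_comp]

theorem Valid.fwdLaw_prod_bwdLaw_map_startPair (hS : S.Valid) (j : Fin N) :
    ((S.fwdLaw j).prod (S.bwdLaw j)).map startPair = (S.π j.castSucc).prod (S.π j.succ) := by
  have := hS.isProbabilityMeasure_fwdLaw j
  have := hS.isProbabilityMeasure_bwdLaw j
  rw [← fwdLaw_map_zero, ← bwdLaw_map_last,
    Measure.map_prod_map _ _ (measurable_pi_apply _) (measurable_pi_apply _)]
  rfl

theorem Valid.ae_rnDeriv_pos_lt_top (hS : S.Valid) (j : Fin N) :
    ∀ᵐ x ∂S.fwdLaw j, 0 < (S.bwdLaw j).rnDeriv (S.fwdLaw j) x ∧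
      (S.bwdLaw j).rnDeriv (S.fwdLaw j) x < ∞ := by
  have := hS.isProbabilityMeasure_fwdLaw j
  have := hS.isProbabilityMeasure_bwdLaw j
  filter_upwards [Measure.rnDeriv_pos' (hS.fwd_ac_bwd j),
    Measure.rnDeriv_lt_top (S.bwdLaw j) (S.fwdLaw j)] with x hx hx' using ⟨hx, hx'⟩

theorem rnDeriv_mul_accept (S : Data N K 𝓧) (j : Fin N) {x x' : Path K 𝓧}
    (hx : 0 < (S.bwdLaw j).rnDeriv (S.fwdLaw j) x ∧ (S.bwdLaw j).rnDeriv (S.fwdLaw j) x < ∞)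
    (hx' : 0 < (S.bwdLaw j).rnDeriv (S.fwdLaw j) x' ∧
      (S.bwdLaw j).rnDeriv (S.fwdLaw j) x' < ∞) :
    (S.bwdLaw j).rnDeriv (S.fwdLaw j) x' * ENNReal.ofReal (S.accept j x x') =
      min ((S.bwdLaw j).rnDeriv (S.fwdLaw j) x) ((S.bwdLaw j).rnDeriv (S.fwdLaw j) x') := by
  unfold accept work
  generalize (S.bwdLaw j).rnDeriv (S.fwdLaw j) x = r at hx ⊢
  generalize (S.bwdLaw j).rnDeriv (S.fwdLaw j) x' = r' at hx' ⊢
  lift r to NNReal using hx.2.ne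
  lift r' to NNReal using hx'.2.ne
  have hr : (0 : ℝ) < r := by simpa using hx.1
  have hr' : (0 : ℝ) < r' := by simpa using hx'.1
  have accept_eq : Real.exp (min 0 (S.ΔFstep j - Real.log r' - (S.ΔFstep j - Real.log r))) =
      min 1 ((r : ℝ) / r') := by
    rw [Real.exp_monotone.map_min, Real.exp_zero, sub_sub_sub_cancel_left, Real.exp_sub,
      Real.exp_log hr, Real.exp_log hr']
  rw [ENNReal.coe_toReal, ENNReal.coe_toReal, accept_eq, ← ENNReal.ofReal_coe_nnreal (p := r'),
    ← ENNReal.ofReal_mul hr'.le, ← ENNReal.ofReal_coe_nnreal (p := r), ← ENNReal.ofReal_min,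
    mul_min_of_nonneg _ _ hr'.le, mul_one, mul_div_cancel₀ _ hr'.ne', min_comm]

/- Writing `ρ = dℚ / dℙ`, the law `ℙ ⊗ ℚ` of the two paths weighted by the acceptance probability
has the symmetric density `min (ρ x) (ρ x')` with respect to `ℙ ⊗ ℙ`. -/
theorem Valid.measurePreserving_swap_withDensity_accept (hS : S.Valid) (j : Fin N) :
    MeasurePreserving Prod.swap
      (((S.fwdLaw j).prod (S.bwdLaw j)).withDensity
        fun z => ENNReal.ofReal (S.accept j z.1 z.2))
      (((S.fwdLaw j).prod (S.bwdLaw j)).withDensity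
        fun z => ENNReal.ofReal (S.accept j z.1 z.2)) := by
  have := hS.isProbabilityMeasure_fwdLaw j
  have := hS.isProbabilityMeasure_bwdLaw j
  set P := S.fwdLaw j
  set ρ := (S.bwdLaw j).rnDeriv P
  have hρ : Measurable ρ := Measure.measurable_rnDeriv _ _
  have bwdLaw_eq : S.bwdLaw j = P.withDensity ρ :=
    (Measure.withDensity_rnDeriv_eq _ _ (hS.bwd_ac_fwd j)).symm
  have ae_eq_min : (fun z => ρ z.2 * ENNReal.ofReal (S.accept j z.1 z.2)) =ᵐ[P.prod P]
      fun z => min (ρ z.1) (ρ z.2) := by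
    filter_upwards [Measure.quasiMeasurePreserving_fst.ae (hS.ae_rnDeriv_pos_lt_top j),
      Measure.quasiMeasurePreserving_snd.ae (hS.ae_rnDeriv_pos_lt_top j)] with z hz hz'
      using S.rnDeriv_mul_accept j hz hz'
  have withDensity_eq : (P.prod (S.bwdLaw j)).withDensity
      (fun z => ENNReal.ofReal (S.accept j z.1 z.2)) =
        (P.prod P).withDensity fun z => min (ρ z.1) (ρ z.2) := by
    have measurable_density : Measurable fun z : Path K 𝓧 × Path K 𝓧 => ρ z.2 :=
      hρ.comp measurable_snd
    rw [bwdLaw_eq, prod_withDensity_right hρ,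
      ← withDensity_mul _ measurable_density (S.measurable_accept j).ennreal_ofReal]
    exact withDensity_congr_ae ae_eq_min
  rw [withDensity_eq]
  exact measurePreserving_withDensity Measure.measurePreserving_swap
    ((hρ.comp measurable_fst).min (hρ.comp measurable_snd)) fun z => min_comm _ _

theorem Valid.prod_bind_pairKernel (hS : S.Valid) (j : Fin N) :
    ((S.π j.castSucc).prod (S.π j.succ)).bind (S.pairKernel j) =
      (S.π j.castSucc).prod (S.π j.succ) := by
  have := hS.isProbabilityMeasure_π
  have := hS.isProbabilityMeasure_fwdLaw j
  have := hS.isProbabilityMeasure_bwdLaw j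
  have hswap := S.measurable_swapPair_startPair j
  refine Measure.ext_of_lintegral _ fun g hg => ?_
  rw [pairKernel_eq_map_startPair, ← Measure.map_comp _ _ hswap, prod_bind_pairDraw,
    lintegral_map hg hswap, lintegral_swapPair _ _ _ _ measurable_startPair hg,
    ← hS.fwdLaw_prod_bwdLaw_map_startPair, lintegral_map hg measurable_startPair]
  exact lintegral_accept_reject (S.measurable_accept j).ennreal_ofReal
    (fun z => ENNReal.ofReal_le_one.2 (S.accept_le_one j _ _))
    (hS.measurePreserving_swap_withDensity_accept j) (hg.comp measurable_startPair)

end Invariance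

end Data

section ProposedSwaps

variable {N : ℕ}

/-- The swaps `i` and `j` involve different chains. -/
def Apart (i j : Fin N) : Prop :=
  i.castSucc ≠ j.castSucc ∧ i.castSucc ≠ j.succ ∧ i.succ ≠ j.castSucc ∧ i.succ ≠ j.succ

/-- The swaps proposed at iteration `t`, in increasing order. -/
def proposedSwaps (N t : ℕ) : List (Fin N) := (List.finRange N).filter fun j => Proposed t j

theorem mem_proposedSwaps {t : ℕ} {j : Fin N} : j ∈ proposedSwaps N t ↔ Proposed t j := by
  simp [proposedSwaps]

theorem pairwise_apart_proposedSwaps (N t : ℕ) : (proposedSwaps N t).Pairwise Apart := by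
  have nodup : (proposedSwaps N t).Nodup := (List.nodup_finRange N).filter _
  refine (List.Pairwise.and_mem.1 nodup).imp ?_
  rintro i j ⟨hi, hj, hij⟩
  rw [mem_proposedSwaps, Proposed, Nat.ModEq] at hi hj
  have val_ne : (i : ℕ) ≠ j := fun h => hij (Fin.ext h)
  simp only [Apart, ne_eq, Fin.ext_iff, Fin.val_castSucc, Fin.val_succ]
  omega

theorem bodd_toNat_modEq (t : ℕ) : t.bodd.toNat ≡ t [MOD 2] := by
  rw [Nat.ModEq, Nat.mod_two_of_bodd t]
  cases t.bodd <;> rfl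

theorem proposed_congr {s t : ℕ} (h : s ≡ t [MOD 2]) (j : Fin N) : Proposed s j ↔ Proposed t j :=
  ⟨fun hj => hj.trans h, fun hj => hj.trans h.symm⟩

theorem proposedSwaps_congr {s t : ℕ} (h : s ≡ t [MOD 2]) :
    proposedSwaps N s = proposedSwaps N t :=
  List.filter_congr fun j _ => decide_eq_decide.2 (proposed_congr h j)

end ProposedSwaps

namespace Data

variable {N K : ℕ} (S : Data N K 𝓧)

section SwapState

variable (j : Fin N)

/-- The state after the swap `j` with draw `d`. -/
noncomputable def swapState (d : Draw K 𝓧) (y : State N 𝓧) : State N 𝓧 :=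
  Function.update (Function.update y j.castSucc (S.swapPair j d (y j.castSucc, y j.succ)).1)
    j.succ (S.swapPair j d (y j.castSucc, y j.succ)).2

theorem swapState_of_ne (d : Draw K 𝓧) (y : State N 𝓧) {i : Fin (N + 1)}
    (h_castSucc : i ≠ j.castSucc) (h_succ : i ≠ j.succ) : S.swapState j d y i = y i := by
  rw [swapState, Function.update_of_ne h_succ, Function.update_of_ne h_castSucc]

theorem swapState_castSucc (d : Draw K 𝓧) (y : State N 𝓧) :
    S.swapState j d y j.castSucc = (S.swapPair j d (y j.castSucc, y j.succ)).1 := by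
  rw [swapState, Function.update_of_ne Fin.castSucc_lt_succ.ne, Function.update_self]

theorem swapState_succ (d : Draw K 𝓧) (y : State N 𝓧) :
    S.swapState j d y j.succ = (S.swapPair j d (y j.castSucc, y j.succ)).2 := by
  rw [swapState, Function.update_self]

theorem measurable_swapState :
    Measurable fun p : State N 𝓧 × Draw K 𝓧 => S.swapState j p.2 p.1 := by
  have measurable_chains : Measurable fun p : State N 𝓧 × Draw K 𝓧 =>
      ((p.1 j.castSucc, p.1 j.succ), p.2) := by fun_prop
  exact (measurable_update_update j.castSucc j.succ).comp
    (measurable_fst.prodMk ((S.measurable_swapPair j).comp measurable_chains))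

/-- The swap `j`, as a kernel on states. -/
noncomputable def swapKernel : Kernel (State N 𝓧) (State N 𝓧) :=
  liftPair j.castSucc j.succ (S.pairKernel j)

instance : IsMarkovKernel (S.swapKernel j) := by
  unfold swapKernel
  infer_instance

theorem swapKernel_apply (y : State N 𝓧) :
    S.swapKernel j y = (S.drawKernel j y).map fun d => S.swapState j d y := by
  have measurable_swapPair_left : Measurable fun d : Draw K 𝓧 =>
      S.swapPair j d (y j.castSucc, y j.succ) :=
    (S.measurable_swapPair j).comp measurable_prodMk_left
  have measurable_update_left : Measurable fun q : 𝓧 × 𝓧 =>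
      Function.update (Function.update y j.castSucc q.1) j.succ q.2 :=
    (measurable_update_update j.castSucc j.succ).comp measurable_prodMk_left
  rw [swapKernel, liftPair_apply, pairKernel_apply, drawKernel_apply,
    Measure.map_map measurable_update_left measurable_swapPair_left]
  rfl

end SwapState

section SwapAll

/-- The state after carrying out a list of swaps, the swap `j` with the draw `d j`. -/
noncomputable def swapAll : List (Fin N) → (Fin N → Draw K 𝓧) → State N 𝓧 → State N 𝓧
  | [], _, y => y
  | j :: l, d, y => swapAll l d (S.swapState j (d j) y)

theorem measurable_swapAll (l : List (Fin N)) :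
    Measurable fun p : State N 𝓧 × (Fin N → Draw K 𝓧) => S.swapAll l p.2 p.1 := by
  induction l with
  | nil => exact measurable_fst
  | cons j l ih =>
    have measurable_draw : Measurable fun p : State N 𝓧 × (Fin N → Draw K 𝓧) => (p.1, p.2 j) := by
      fun_prop
    exact ih.comp (((S.measurable_swapState j).comp measurable_draw).prodMk measurable_snd)

theorem swapAll_congr {l : List (Fin N)} {d d' : Fin N → Draw K 𝓧} (h : ∀ j ∈ l, d j = d' j)
    (y : State N 𝓧) : S.swapAll l d y = S.swapAll l d' y := by
  induction l generalizing y with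
  | nil => rfl
  | cons k l ih =>
    rw [List.forall_mem_cons] at h
    rw [swapAll, swapAll, h.1, ih h.2]

theorem swapAll_of_ne {l : List (Fin N)} (d : Fin N → Draw K 𝓧) (y : State N 𝓧)
    {i : Fin (N + 1)} (h : ∀ j ∈ l, i ≠ j.castSucc ∧ i ≠ j.succ) : S.swapAll l d y i = y i := by
  induction l generalizing y with
  | nil => rfl
  | cons k l ih =>
    rw [List.forall_mem_cons] at h
    rw [swapAll, ih _ h.2, S.swapState_of_ne k _ _ h.1.1 h.1.2]

theorem swapAll_of_mem {l : List (Fin N)} (hl : l.Pairwise Apart) (d : Fin N → Draw K 𝓧)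
    (y : State N 𝓧) {j : Fin N} (hj : j ∈ l) :
    S.swapAll l d y j.castSucc = (S.swapPair j (d j) (y j.castSucc, y j.succ)).1 ∧
      S.swapAll l d y j.succ = (S.swapPair j (d j) (y j.castSucc, y j.succ)).2 := by
  induction l generalizing y with
  | nil => exact absurd hj List.not_mem_nil
  | cons k l ih =>
    rw [List.pairwise_cons] at hl
    rw [swapAll]
    rcases List.mem_cons.1 hj with rfl | hj
    · rw [S.swapAll_of_ne _ _ fun i hi => ⟨(hl.1 i hi).1, (hl.1 i hi).2.1⟩,
        S.swapAll_of_ne _ _ fun i hi => ⟨(hl.1 i hi).2.2.1, (hl.1 i hi).2.2.2⟩,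
        swapState_castSucc, swapState_succ]
      exact ⟨rfl, rfl⟩
    · obtain ⟨hcc, hcs, hsc, hss⟩ := hl.1 j hj
      have swapAll_eq := ih hl.2 (S.swapState k (d k) y) hj
      rwa [S.swapState_of_ne k _ y hcc.symm hsc.symm,
        S.swapState_of_ne k _ y hcs.symm hss.symm] at swapAll_eq

theorem communicate_eq_swapAll (t : ℕ) (y : State N 𝓧) (d : Fin N → Draw K 𝓧) :
    S.communicate t y d = S.swapAll (proposedSwaps N t) d y := by
  have hl := pairwise_apart_proposedSwaps N t
  ext1 i
  unfold communicate
  by_cases h_succ : 0 < (i : ℕ) ∧ (i : ℕ) ≡ t [MOD 2]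
  · rw [dif_pos h_succ]
    obtain ⟨j, rfl⟩ := Fin.exists_succ_eq.2 (Fin.pos_iff_ne_zero.1 h_succ.1)
    rw [(S.swapAll_of_mem hl d y (mem_proposedSwaps.2 h_succ.2)).2, swapPair, apply_ite Prod.snd]
    rfl
  rw [dif_neg h_succ]
  by_cases h_castSucc : (i : ℕ) < N ∧ (i : ℕ) + 1 ≡ t [MOD 2]
  · rw [dif_pos h_castSucc]
    obtain ⟨j, rfl⟩ : ∃ j : Fin N, j.castSucc = i := ⟨⟨i, h_castSucc.1⟩, rfl⟩
    rw [(S.swapAll_of_mem hl d y (mem_proposedSwaps.2 h_castSucc.2)).1, swapPair,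
      apply_ite Prod.fst]
    rfl
  rw [dif_neg h_castSucc, S.swapAll_of_ne]
  intro j hj
  rw [mem_proposedSwaps] at hj
  constructor
  · rintro rfl
    exact h_castSucc ⟨j.2, hj⟩
  · rintro rfl
    exact h_succ ⟨j.1.succ_pos, hj⟩

theorem communicate_congr {s t : ℕ} (h : s ≡ t [MOD 2]) (y : State N 𝓧)
    (d : Fin N → Draw K 𝓧) : S.communicate s y d = S.communicate t y d := by
  rw [communicate_eq_swapAll, communicate_eq_swapAll, proposedSwaps_congr h]

theorem measurable_communicate (t : ℕ) :
    Measurable fun p : State N 𝓧 × (Fin N → Draw K 𝓧) => S.communicate t p.1 p.2 := by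
  simp only [communicate_eq_swapAll]
  exact S.measurable_swapAll _

/-- The composition of the swaps in the list `l`. -/
noncomputable def swapSeq : List (Fin N) → Kernel (State N 𝓧) (State N 𝓧)
  | [] => Kernel.id
  | j :: l => swapSeq l ∘ₖ S.swapKernel j

instance isMarkovKernel_swapSeq : (l : List (Fin N)) → IsMarkovKernel (S.swapSeq l)
  | [] => by
    unfold swapSeq
    infer_instance
  | j :: l => by
    have := isMarkovKernel_swapSeq l
    unfold swapSeq
    infer_instance

theorem drawKernel_swapState {i j : Fin N} (h : Apart i j) (d : Draw K 𝓧) (y : State N 𝓧) :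
    S.drawKernel j (S.swapState i d y) = S.drawKernel j y := by
  obtain ⟨hcc, hcs, hsc, hss⟩ := h
  rw [drawKernel_apply, drawKernel_apply, S.swapState_of_ne i _ y hcc.symm hsc.symm,
    S.swapState_of_ne i _ y hcs.symm hss.symm]

/- The swaps of an iteration are all drawn from the same state. Since they involve different
chains, this is the same as drawing and carrying out one after the other. -/
theorem pi_map_swapAll {l : List (Fin N)} (hl : l.Pairwise Apart) (y : State N 𝓧)
    (m : Fin N → Measure (Draw K 𝓧)) [∀ j, IsProbabilityMeasure (m j)]
    (hm : ∀ j ∈ l, m j = S.drawKernel j y) :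
    (Measure.pi m).map (fun d => S.swapAll l d y) = S.swapSeq l y := by
  induction l generalizing y with
  | nil =>
    rw [swapSeq, Kernel.id_apply]
    simp only [swapAll]
    rw [Measure.map_const, measure_univ, one_smul]
  | cons j l ih =>
    rw [List.pairwise_cons] at hl
    rw [List.forall_mem_cons] at hm
    have notMem : j ∉ l := fun h => (hl.1 j h).1 rfl
    have measurable_swapAll_left (l : List (Fin N)) (z : State N 𝓧) :
        Measurable fun d : Fin N → Draw K 𝓧 => S.swapAll l d z :=
      (S.measurable_swapAll l).comp measurable_prodMk_left
    have measurable_swapState_left : Measurable fun e : Draw K 𝓧 => S.swapState j e y :=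
      (S.measurable_swapState j).comp measurable_prodMk_left
    have measurable_uncurry : Measurable fun p : (Fin N → Draw K 𝓧) × Draw K 𝓧 =>
        S.swapAll l p.1 (S.swapState j p.2 y) :=
      (S.measurable_swapAll l).comp
        ((measurable_swapState_left.comp measurable_snd).prodMk measurable_fst)
    have swapAll_comp_update : (fun d => S.swapAll (j :: l) d y) ∘
        (fun p : (Fin N → Draw K 𝓧) × Draw K 𝓧 => Function.update p.1 j p.2) =
          fun p => S.swapAll l p.1 (S.swapState j p.2 y) := by
      ext1 p
      simp only [Function.comp_apply, swapAll, Function.update_self]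
      refine S.swapAll_congr (fun i hi => ?_) _
      rw [Function.update_of_ne (ne_of_mem_of_not_mem hi notMem)]
    rw [← Function.update_eq_self j m, ← pi_prod_map_update,
      Measure.map_map (measurable_swapAll_left _ y) measurable_update', swapAll_comp_update]
    ext C hC
    rw [Measure.map_apply measurable_uncurry hC,
      Measure.prod_apply_symm (measurable_uncurry hC), hm.1, swapSeq,
      Kernel.comp_apply' _ _ _ hC, swapKernel_apply,
      lintegral_map (Kernel.measurable_coe _ hC) measurable_swapState_left]
    refine lintegral_congr fun e => ?_
    rw [← ih hl.2 _ fun i hi => (hm.2 i hi).trans (S.drawKernel_swapState (hl.1 i hi) e y).symm,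
      Measure.map_apply (measurable_swapAll_left _ _) hC]
    rfl

end SwapAll

section Iteration

/-- One iteration, as a kernel on states. -/
noncomputable def stateKernel (t : ℕ) : Kernel (State N 𝓧) (State N 𝓧) :=
  S.swapSeq (proposedSwaps N t) ∘ₖ S.exploreKernel

instance : IsMarkovKernel S.exploreKernel := by
  unfold exploreKernel
  infer_instance

instance (t : ℕ) : IsMarkovKernel (S.stateKernel t) := by
  unfold stateKernel
  infer_instance

theorem stateKernel_congr {s t : ℕ} (h : s ≡ t [MOD 2]) : S.stateKernel s = S.stateKernel t := by
  rw [stateKernel, stateKernel, proposedSwaps_congr h]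

/-- The draw for the swap `j` at iteration `t`, with a constant in place of the draws for the swaps
that are not proposed, so that the type of the draws does not depend on `t`. -/
noncomputable def drawOr (d₀ : Draw K 𝓧) (t : ℕ) (j : Fin N) : Kernel (State N 𝓧) (Draw K 𝓧) :=
  if Proposed t j then S.drawKernel j else Kernel.const _ (Measure.dirac d₀)

instance (d₀ : Draw K 𝓧) (t : ℕ) (j : Fin N) : IsMarkovKernel (S.drawOr d₀ t j) := by
  unfold drawOr
  split_ifs <;> infer_instance

theorem drawOr_of_proposed (d₀ : Draw K 𝓧) {t : ℕ} {j : Fin N} (h : Proposed t j) :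
    S.drawOr d₀ t j = S.drawKernel j :=
  if_pos h

/-- All the sampling of iteration `t`, with `d₀` in place of the draws for the swaps that are not
proposed. -/
noncomputable def fullKernel (d₀ : Draw K 𝓧) (t : ℕ) :
    Kernel (State N 𝓧) (State N 𝓧 × (Fin N → Draw K 𝓧)) :=
  S.exploreKernel ⊗ₖ Kernel.prodMkLeft _ (prodKernel (S.drawOr d₀ t))

instance (d₀ : Draw K 𝓧) (t : ℕ) : IsMarkovKernel (S.fullKernel d₀ t) := by
  unfold fullKernel
  infer_instance

theorem fullKernel_congr (d₀ : Draw K 𝓧) {s t : ℕ} (h : s ≡ t [MOD 2]) :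
    S.fullKernel d₀ s = S.fullKernel d₀ t := by
  have drawOr_eq : S.drawOr d₀ s = S.drawOr d₀ t := by
    ext1 j
    simp only [drawOr, proposed_congr h]
  unfold fullKernel
  congr! 3

theorem fullKernel_map_communicate (d₀ : Draw K 𝓧) (t : ℕ) :
    (S.fullKernel d₀ t).map (fun p => S.communicate t p.1 p.2) = S.stateKernel t := by
  have hcomm := S.measurable_communicate t
  ext x C hC
  rw [Kernel.map_apply' _ hcomm _ hC, fullKernel, Kernel.compProd_apply (hcomm hC), stateKernel,
    Kernel.comp_apply' _ _ _ hC]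
  refine lintegral_congr fun y => ?_
  have hswap : Measurable fun d : Fin N → Draw K 𝓧 => S.swapAll (proposedSwaps N t) d y :=
    (S.measurable_swapAll _).comp measurable_prodMk_left
  have drawOr_eq : ∀ j ∈ proposedSwaps N t, S.drawOr d₀ t j y = S.drawKernel j y := fun j hj => by
    rw [S.drawOr_of_proposed d₀ (mem_proposedSwaps.1 hj)]
  rw [← S.pi_map_swapAll (pairwise_apart_proposedSwaps N t) y _ drawOr_eq,
    Measure.map_apply hswap hC, Kernel.prodMkLeft_apply]
  simp only [communicate_eq_swapAll]
  rfl

/-- Extension of the draws for the proposed swaps by the constant `d₀`. -/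
def extendDraw (d₀ : Draw K 𝓧) (t : ℕ) (d : {j : Fin N // Proposed t j} → Draw K 𝓧) (j : Fin N) :
    Draw K 𝓧 :=
  if h : Proposed t j then d ⟨j, h⟩ else d₀

theorem measurable_extendDraw (d₀ : Draw K 𝓧) (t : ℕ) :
    Measurable (extendDraw (N := N) d₀ t) := by
  refine measurable_pi_lambda _ fun j => ?_
  unfold extendDraw
  split_ifs
  · exact measurable_pi_apply _
  · exact measurable_const

theorem measurable_prodMap_extendDraw (d₀ : Draw K 𝓧) (t : ℕ) :
    Measurable (Prod.map id (extendDraw d₀ t) :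
      State N 𝓧 × ({j : Fin N // Proposed t j} → Draw K 𝓧) → State N 𝓧 × (Fin N → Draw K 𝓧)) :=
  measurable_id.prodMap (measurable_extendDraw d₀ t)

theorem prodKernel_drawOr_apply (d₀ : Draw K 𝓧) (t : ℕ) (y : State N 𝓧) :
    prodKernel (S.drawOr d₀ t) y =
      (prodKernel (fun j : {j : Fin N // Proposed t j} => S.drawKernel j) y).map
        (extendDraw d₀ t) := by
  refine Eq.trans ?_ (pi_map_extend_const (Proposed t) (fun j => S.drawKernel j y) d₀).symm
  change Measure.pi _ = _
  congr! with j
  unfold drawOr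
  split_ifs <;> rfl

theorem iterKernel_map_extendDraw (d₀ : Draw K 𝓧) (t : ℕ) :
    (S.iterKernel t).map (Prod.map id (extendDraw d₀ t)) = S.fullKernel d₀ t := by
  have hmap := measurable_prodMap_extendDraw (N := N) d₀ t
  ext x C hC
  rw [Kernel.map_apply' _ hmap _ hC, iterKernel, fullKernel, Kernel.compProd_apply (hmap hC),
    Kernel.compProd_apply hC]
  refine lintegral_congr fun y => ?_
  rw [Kernel.prodMkLeft_apply, Kernel.prodMkLeft_apply, prodKernel_drawOr_apply,
    Measure.map_apply (measurable_extendDraw d₀ t) (measurable_prodMk_left hC)]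
  rfl

end Iteration

end Data

section Harmonic

variable {E : Type*} [MeasurableSpace E] {κ : Kernel E E} [IsMarkovKernel κ] {Γ : Measure E}
  [IsProbabilityMeasure Γ]

theorem ae_snd_eq_fst_of_harmonic (hinv : κ.Invariant Γ) {g : E → ℝ} (hg : MemLp g 2 Γ)
    (harm : ∀ᵐ x ∂Γ, ∫ y, g y ∂κ x = g x) : ∀ᵐ p ∂(Γ ⊗ₘ κ), g p.2 = g p.1 := by
  have preserving_fst : MeasurePreserving Prod.fst (Γ ⊗ₘ κ) Γ :=
    ⟨measurable_fst, Measure.fst_compProd ..⟩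
  have preserving_snd : MeasurePreserving Prod.snd (Γ ⊗ₘ κ) Γ :=
    ⟨measurable_snd, (Measure.snd_compProd ..).trans hinv.def⟩
  have memLp_fst : MemLp (fun p : E × E => g p.1) 2 (Γ ⊗ₘ κ) :=
    hg.comp_measurePreserving preserving_fst
  have memLp_snd : MemLp (fun p : E × E => g p.2) 2 (Γ ⊗ₘ κ) :=
    hg.comp_measurePreserving preserving_snd
  have integrable_mul : Integrable (fun p : E × E => g p.1 * g p.2) (Γ ⊗ₘ κ) :=
    memLp_fst.integrable_mul memLp_snd
  have integral_fst : ∫ p, g p.1 ^ 2 ∂(Γ ⊗ₘ κ) = ∫ x, g x ^ 2 ∂Γ :=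
    preserving_fst.hasLaw.integral_comp (hg.1.pow 2)
  have integral_snd : ∫ p, g p.2 ^ 2 ∂(Γ ⊗ₘ κ) = ∫ x, g x ^ 2 ∂Γ :=
    preserving_snd.hasLaw.integral_comp (hg.1.pow 2)
  have integral_mul : ∫ p, g p.1 * g p.2 ∂(Γ ⊗ₘ κ) = ∫ x, g x ^ 2 ∂Γ := by
    rw [Measure.integral_compProd integrable_mul]
    refine integral_congr_ae (harm.mono fun x hx => ?_)
    simp only
    rw [integral_const_mul, hx, pow_two]
  have integral_sub_sq : ∫ p, (g p.2 - g p.1) ^ 2 ∂(Γ ⊗ₘ κ) = 0 := by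
    have expand : ∀ p : E × E, (g p.2 - g p.1) ^ 2 =
        g p.2 ^ 2 + g p.1 ^ 2 - 2 * (g p.1 * g p.2) := fun p => by ring
    simp only [expand]
    rw [integral_sub (by exact memLp_snd.integrable_sq.add memLp_fst.integrable_sq)
      (integrable_mul.const_mul 2), integral_add memLp_snd.integrable_sq memLp_fst.integrable_sq,
      integral_const_mul, integral_fst, integral_snd, integral_mul]
    ring
  have sub_sq_eq_zero := (integral_eq_zero_iff_of_nonneg (fun p : E × E => sq_nonneg _)
    (memLp_snd.sub memLp_fst).integrable_sq).1 integral_sub_sq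
  exact sub_sq_eq_zero.mono fun p hp => sub_eq_zero.1 (pow_eq_zero_iff two_ne_zero |>.1 hp)

theorem isLiouville_of_forall_absolutelyContinuous (hinv : κ.Invariant Γ)
    (hac : ∀ x, Γ ≪ κ x) : IsLiouville κ Γ := by
  intro h hm h_le_one harm
  have h_lt_top : ∀ x, h x < ∞ := fun x => (h_le_one x).trans_lt ENNReal.one_lt_top
  have memLp : MemLp (fun x => (h x).toReal) 2 Γ := by
    refine MemLp.of_bound hm.ennreal_toReal.aestronglyMeasurable 1 (.of_forall fun x => ?_)
    rw [Real.norm_of_nonneg ENNReal.toReal_nonneg]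
    exact ENNReal.toReal_mono ENNReal.one_ne_top (h_le_one x)
  have harm_toReal : ∀ x, ∫ y, (h y).toReal ∂κ x = (h x).toReal := fun x => by
    rw [integral_toReal hm.aemeasurable (.of_forall h_lt_top), harm]
  obtain ⟨x, hx⟩ := (Measure.ae_ae_of_ae_compProd
    (ae_snd_eq_fst_of_harmonic hinv memLp (.of_forall harm_toReal))).exists
  refine ⟨h x, (hac x).ae_le (hx.mono fun y hy => ?_)⟩
  exact (ENNReal.toReal_eq_toReal_iff' (h_lt_top y).ne (h_lt_top x).ne).1 hy

end Harmonic

section SwapPerm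

variable {N : ℕ}

/-- The permutation of the chains effected by the swaps in the list `l` if they are all accepted:
chain `i` then receives a state coming from chain `swapPerm l i`. -/
def swapPerm (l : List (Fin N)) : Equiv.Perm (Fin (N + 1)) :=
  (l.map fun j => Equiv.swap j.castSucc j.succ).prod

theorem swapPerm_cons_apply (j : Fin N) (l : List (Fin N)) (i : Fin (N + 1)) :
    swapPerm (j :: l) i = Equiv.swap j.castSucc j.succ (swapPerm l i) := by
  simp only [swapPerm, List.map_cons, List.prod_cons, Equiv.Perm.mul_apply]

theorem swapPerm_of_ne {l : List (Fin N)} {i : Fin (N + 1)}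
    (h : ∀ j ∈ l, i ≠ j.castSucc ∧ i ≠ j.succ) : swapPerm l i = i := by
  induction l with
  | nil => rfl
  | cons k l ih =>
    rw [List.forall_mem_cons] at h
    rw [swapPerm_cons_apply, ih h.2, Equiv.swap_apply_of_ne_of_ne h.1.1 h.1.2]

theorem swapPerm_of_mem {l : List (Fin N)} (hl : l.Pairwise Apart) {j : Fin N} (hj : j ∈ l) :
    swapPerm l j.castSucc = j.succ ∧ swapPerm l j.succ = j.castSucc := by
  induction l with
  | nil => exact absurd hj List.not_mem_nil
  | cons k l ih =>
    rw [List.pairwise_cons] at hl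
    rw [swapPerm_cons_apply, swapPerm_cons_apply]
    rcases List.mem_cons.1 hj with rfl | hj
    · rw [swapPerm_of_ne fun i hi => ⟨(hl.1 i hi).1, (hl.1 i hi).2.1⟩,
        swapPerm_of_ne fun i hi => ⟨(hl.1 i hi).2.2.1, (hl.1 i hi).2.2.2⟩]
      exact ⟨Equiv.swap_apply_left _ _, Equiv.swap_apply_right _ _⟩
    · obtain ⟨hcc, hcs, hsc, hss⟩ := hl.1 j hj
      rw [(ih hl.2 hj).1, (ih hl.2 hj).2]
      exact ⟨Equiv.swap_apply_of_ne_of_ne hcs.symm hss.symm,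
        Equiv.swap_apply_of_ne_of_ne hcc.symm hsc.symm⟩

theorem val_swapPerm_proposedSwaps (t : ℕ) (i : Fin (N + 1)) :
    (swapPerm (proposedSwaps N t) i : ℕ) =
      if 0 < (i : ℕ) ∧ (i : ℕ) ≡ t [MOD 2] then (i : ℕ) - 1
      else if (i : ℕ) < N ∧ (i : ℕ) + 1 ≡ t [MOD 2] then i + 1 else i := by
  have hl := pairwise_apart_proposedSwaps N t
  split_ifs with h_succ h_castSucc
  · obtain ⟨j, rfl⟩ := Fin.exists_succ_eq.2 (Fin.pos_iff_ne_zero.1 h_succ.1)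
    rw [(swapPerm_of_mem hl (mem_proposedSwaps.2 h_succ.2)).2]
    rfl
  · obtain ⟨j, rfl⟩ : ∃ j : Fin N, j.castSucc = i := ⟨⟨i, h_castSucc.1⟩, rfl⟩
    rw [(swapPerm_of_mem hl (mem_proposedSwaps.2 h_castSucc.2)).1]
    rfl
  · rw [swapPerm_of_ne]
    intro j hj
    rw [mem_proposedSwaps] at hj
    constructor
    · rintro rfl
      exact h_castSucc ⟨j.2, hj⟩
    · rintro rfl
      exact h_succ ⟨j.1.succ_pos, hj⟩

end SwapPerm

namespace Data

variable {N K : ℕ} {S : Data N K 𝓧}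

section Invariance

theorem Valid.isProbabilityMeasure_jointπ (hS : S.Valid) : IsProbabilityMeasure S.jointπ := by
  have := hS.isProbabilityMeasure_π
  unfold jointπ
  infer_instance

theorem Valid.invariant_exploreKernel (hS : S.Valid) : S.exploreKernel.Invariant S.jointπ := by
  have := hS.isProbabilityMeasure_π
  rw [Kernel.Invariant, jointπ, exploreKernel, pi_bind_prodKernel]
  simp only [(hS.explore_invariant _).def]

theorem Valid.invariant_swapKernel (hS : S.Valid) (j : Fin N) :
    (S.swapKernel j).Invariant S.jointπ := by
  have := hS.isProbabilityMeasure_π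
  have pi_bind := pi_bind_liftPair S.π Fin.castSucc_lt_succ.ne _ (hS.prod_bind_pairKernel j)
  rwa [Function.update_eq_self, Function.update_eq_self] at pi_bind

theorem Valid.invariant_swapSeq (hS : S.Valid) (l : List (Fin N)) :
    (S.swapSeq l).Invariant S.jointπ := by
  induction l with
  | nil => exact Measure.id_comp
  | cons j l ih => exact ih.comp (hS.invariant_swapKernel j)

theorem Valid.invariant_stateKernel (hS : S.Valid) (t : ℕ) :
    (S.stateKernel t).Invariant S.jointπ :=
  (hS.invariant_swapSeq _).comp hS.invariant_exploreKernel

/-- The first `t` iterations, as a kernel on states. -/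
noncomputable def iterate (S : Data N K 𝓧) : ℕ → Kernel (State N 𝓧) (State N 𝓧)
  | 0 => Kernel.id
  | t + 1 => S.stateKernel (t + 1) ∘ₖ iterate S t

instance isMarkovKernel_iterate : (t : ℕ) → IsMarkovKernel (S.iterate t)
  | 0 => by
    unfold iterate
    infer_instance
  | t + 1 => by
    have := isMarkovKernel_iterate t
    unfold iterate
    infer_instance

theorem Valid.invariant_iterate (hS : S.Valid) (t : ℕ) : (S.iterate t).Invariant S.jointπ := by
  induction t with
  | zero => exact Measure.id_comp
  | succ t ih => exact (hS.invariant_stateKernel _).comp ih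

end Invariance

section Fresh

/-- `ν` dominates a product of probability measures whose marginals at the chains in `F` dominate
those of `S.jointπ`. With `F` growing along the iterations, this measures how far draws from the
reference have spread. -/
def Fresh (S : Data N K 𝓧) (F : Set (Fin (N + 1))) (ν : Measure (State N 𝓧)) : Prop :=
  ∃ m : Fin (N + 1) → Measure 𝓧, (∀ i, IsProbabilityMeasure (m i)) ∧ (∀ i ∈ F, S.π i ≪ m i) ∧
    Measure.pi m ≪ ν

variable {F : Set (Fin (N + 1))} {ν : Measure (State N 𝓧)}

theorem Fresh.mono {F' : Set (Fin (N + 1))} (h : S.Fresh F ν) (hF : F' ⊆ F) : S.Fresh F' ν := by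
  obtain ⟨m, isProb, hm, hν⟩ := h
  exact ⟨m, isProb, fun i hi => hm i (hF hi), hν⟩

theorem fresh_dirac (S : Data N K 𝓧) (x : State N 𝓧) : S.Fresh ∅ (Measure.dirac x) :=
  ⟨fun i => Measure.dirac (x i), fun _ => inferInstance, fun _ h => absurd h (Set.notMem_empty _),
    pi_dirac x ▸ Measure.AbsolutelyContinuous.rfl⟩

theorem Fresh.explore (hS : S.Valid) (h : S.Fresh F ν) :
    S.Fresh (insert 0 F) (ν.bind S.exploreKernel) := by
  obtain ⟨m, isProb, hm, hν⟩ := h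
  refine ⟨fun i => (m i).bind (S.explore i), fun i => inferInstance, fun i hi => ?_, ?_⟩
  · rcases hi with rfl | hi
    · simp only
      rw [hS.explore_zero, Measure.const_comp, measure_univ, one_smul]
    · conv_lhs => rw [← (hS.explore_invariant i).def]
      exact (hm i hi).comp_right _
  · rw [← pi_bind_prodKernel]
    exact hν.comp_right _

theorem Valid.π_succ_absolutelyContinuous (hS : S.Valid) {j : Fin N} {μ : Measure 𝓧}
    (h : S.π j.castSucc ≪ μ) :
    S.π j.succ ≪ (μ.bind (pathKernel K (S.fwd j))).map fun p => p (Fin.last K) := by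
  rw [← S.bwdLaw_map_last j]
  exact ((hS.bwd_ac_fwd j).trans (h.comp_right _)).map (measurable_pi_apply _)

theorem Valid.π_castSucc_absolutelyContinuous (hS : S.Valid) {j : Fin N} {μ : Measure 𝓧}
    (h : S.π j.succ ≪ μ) :
    S.π j.castSucc ≪ (μ.bind (revPathKernel K (S.bwd j))).map fun p => p 0 := by
  rw [← S.fwdLaw_map_zero j]
  exact ((hS.fwd_ac_bwd j).trans (h.comp_right _)).map (measurable_pi_apply _)

theorem liftPair_forcedKernel_absolutelyContinuous_swapKernel (S : Data N K 𝓧) (j : Fin N)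
    (y : State N 𝓧) :
    liftPair j.castSucc j.succ (S.forcedKernel j) y ≪ S.swapKernel j y := by
  rw [swapKernel, liftPair_apply, liftPair_apply]
  exact (S.forcedKernel_absolutelyContinuous_pairKernel j _).map
    ((measurable_update_update j.castSucc j.succ).comp measurable_prodMk_left)

theorem Fresh.swap (hS : S.Valid) (h : S.Fresh F ν) (j : Fin N) :
    S.Fresh {i | Equiv.swap j.castSucc j.succ i ∈ F} (ν.bind (S.swapKernel j)) := by
  obtain ⟨m, isProb, hm, hν⟩ := h
  have hne : j.castSucc ≠ j.succ := Fin.castSucc_lt_succ.ne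
  set b := ((m j.succ).bind (revPathKernel K (S.bwd j))).map fun p => p 0
  set f := ((m j.castSucc).bind (pathKernel K (S.fwd j))).map fun p => p (Fin.last K)
  have : IsProbabilityMeasure b :=
    Measure.isProbabilityMeasure_map (measurable_pi_apply _).aemeasurable
  have : IsProbabilityMeasure f :=
    Measure.isProbabilityMeasure_map (measurable_pi_apply _).aemeasurable
  refine ⟨Function.update (Function.update m j.castSucc b) j.succ f, inferInstance,
    fun i hi => ?_, ?_⟩
  · rw [Set.mem_ofPred_eq] at hi
    rcases eq_or_ne i j.succ with rfl | h_succ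
    · rw [Equiv.swap_apply_right] at hi
      rw [Function.update_self]
      exact hS.π_succ_absolutelyContinuous (hm _ hi)
    rw [Function.update_of_ne h_succ]
    rcases eq_or_ne i j.castSucc with rfl | h_castSucc
    · rw [Equiv.swap_apply_left] at hi
      rw [Function.update_self]
      exact hS.π_castSucc_absolutelyContinuous (hm _ hi)
    rw [Equiv.swap_apply_of_ne_of_ne h_castSucc h_succ] at hi
    rw [Function.update_of_ne h_castSucc]
    exact hm i hi
  · rw [← pi_bind_liftPair m hne (S.forcedKernel j) (S.prod_bind_forcedKernel j _ _)]
    exact Measure.AbsolutelyContinuous.comp hν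
      (.of_forall (S.liftPair_forcedKernel_absolutelyContinuous_swapKernel j))

theorem Fresh.swapSeq (hS : S.Valid) (h : S.Fresh F ν) (l : List (Fin N)) :
    S.Fresh {i | swapPerm l i ∈ F} (ν.bind (S.swapSeq l)) := by
  induction l generalizing F ν with
  | nil =>
    rw [Data.swapSeq, Measure.id_comp]
    exact h
  | cons j l ih =>
    rw [Data.swapSeq, ← Measure.comp_assoc]
    simp only [swapPerm_cons_apply]
    exact ih (h.swap hS j)

/- If all swaps are accepted, draws from the reference move up from chain `0` to chain `N` and
then down again. -/
theorem Valid.fresh_iterate (hS : S.Valid) (x : State N 𝓧) (t : ℕ) :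
    S.Fresh {i | t ≠ 0 ∧ (((i : ℕ) % 2 = t % 2 ∧ (i : ℕ) ≤ t) ∨
      ((i : ℕ) % 2 ≠ t % 2 ∧ 2 * N + 1 ≤ t + i))} (S.iterate t x) := by
  induction t with
  | zero =>
    rw [iterate, Kernel.id_apply]
    exact (S.fresh_dirac x).mono fun i hi => absurd rfl hi.1
  | succ t ih =>
    rw [iterate, Kernel.comp_apply, stateKernel, ← Measure.comp_assoc]
    refine ((ih.explore hS).swapSeq hS (proposedSwaps N (t + 1))).mono fun i hi => ?_
    have i_lt := i.is_lt
    have val_swapPerm := val_swapPerm_proposedSwaps (t + 1) i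
    simp only [Set.mem_ofPred_eq, Set.mem_insert_iff, Fin.ext_iff, Fin.val_zero] at hi ⊢
    unfold Nat.ModEq at val_swapPerm
    split_ifs at val_swapPerm <;> omega

theorem Valid.jointπ_absolutelyContinuous_iterate (hS : S.Valid) (x : State N 𝓧) :
    S.jointπ ≪ S.iterate (2 * (N + 1)) x := by
  have := hS.isProbabilityMeasure_π
  obtain ⟨m, isProb, hm, hν⟩ := hS.fresh_iterate x (2 * (N + 1))
  refine (pi_absolutelyContinuous_pi fun i => hm i ?_).trans hν
  have i_lt := i.is_lt
  simp only [Set.mem_ofPred_eq]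
  omega

end Fresh

section Harmonic

variable {h : Bool → State N 𝓧 → ℝ≥0∞}

theorem lintegral_iterate_of_harmonic (S : Data N K 𝓧) (hm : ∀ b, Measurable (h b))
    (harm : ∀ b x, ∫⁻ y, h (!b) y ∂S.stateKernel (!b).toNat x = h b x) (t : ℕ) (x : State N 𝓧) :
    ∫⁻ y, h t.bodd y ∂S.iterate t x = h false x := by
  induction t generalizing x with
  | zero =>
    rw [iterate, Kernel.id_apply, lintegral_dirac' _ (hm _)]
    rfl
  | succ t ih =>
    rw [iterate, Kernel.lintegral_comp _ _ _ (hm _), ← ih x]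
    refine lintegral_congr fun y => ?_
    rw [← S.stateKernel_congr (bodd_toNat_modEq _), Nat.bodd_succ, harm]

/- The iterations depend on the parity of `t` only, so a bounded harmonic function of the state and
the parity of time is a pair `h`. -/
theorem Valid.ae_eq_const_of_harmonic (hS : S.Valid) (hm : ∀ b, Measurable (h b))
    (h_le_one : ∀ b x, h b x ≤ 1)
    (harm : ∀ b x, ∫⁻ y, h (!b) y ∂S.stateKernel (!b).toNat x = h b x) :
    ∃ c, ∀ b, h b =ᵐ[S.jointπ] fun _ => c := by
  have := hS.isProbabilityMeasure_jointπ
  obtain ⟨c, h_false⟩ := isLiouville_of_forall_absolutelyContinuous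
    (hS.invariant_iterate (2 * (N + 1))) hS.jointπ_absolutelyContinuous_iterate (h false)
    (hm false) (h_le_one false) fun x => by
      simpa using S.lintegral_iterate_of_harmonic hm harm (2 * (N + 1)) x
  refine ⟨c, Bool.forall_bool.2 ⟨h_false, ?_⟩⟩
  have h_false_bind : ∀ᵐ y ∂S.jointπ.bind (S.stateKernel 0), h false y = c := by
    rw [(hS.invariant_stateKernel 0).def]
    exact h_false
  filter_upwards [Measure.ae_ae_of_ae_bind (Kernel.aemeasurable _) h_false_bind] with x hx
  calc h true x = ∫⁻ y, h false y ∂S.stateKernel 0 x := (harm true x).symm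
    _ = ∫⁻ _, c ∂S.stateKernel 0 x := lintegral_congr_ae hx
    _ = c := by rw [lintegral_const, measure_univ, mul_one]

end Harmonic

end Data

/-- What happens in one iteration: its parity, the state after local exploration, and the draws.
Since the transitions alternate between odd and even iterations, the parity is needed to make the
sequence of records a time-homogeneous Markov chain. -/
abbrev Record (N K : ℕ) (𝓧 : Type*) := Bool × (State N 𝓧 × (Fin N → Draw K 𝓧))

namespace Data

variable {N K : ℕ} (S : Data N K 𝓧)

section RecordKernel

/-- The state at the end of an iteration with record `r`. -/
noncomputable def nextState (r : Record N K 𝓧) : State N 𝓧 :=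
  S.communicate r.1.toNat r.2.1 r.2.2

theorem measurable_nextState : Measurable (S.nextState (K := K)) :=
  measurable_from_prod_countable_right fun b => S.measurable_communicate b.toNat

/-- The transition kernel from the record of an iteration to that of the next one. -/
noncomputable def recordKernel (d₀ : Draw K 𝓧) : Kernel (Record N K 𝓧) (Record N K 𝓧) where
  toFun r := (S.fullKernel d₀ (!r.1).toNat (S.nextState r)).map (Prod.mk (!r.1))
  measurable' := measurable_from_prod_countable_right fun b =>
    (Measure.measurable_map (Prod.mk (!b)) measurable_prodMk_left).comp
      ((S.fullKernel d₀ (!b).toNat).measurable.comp (S.measurable_communicate b.toNat))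

theorem recordKernel_apply (d₀ : Draw K 𝓧) (r : Record N K 𝓧) :
    S.recordKernel d₀ r = (S.fullKernel d₀ (!r.1).toNat (S.nextState r)).map (Prod.mk (!r.1)) :=
  rfl

instance (d₀ : Draw K 𝓧) : IsMarkovKernel (S.recordKernel d₀) :=
  ⟨fun _ => Measure.isProbabilityMeasure_map measurable_prodMk_left.aemeasurable⟩

theorem lintegral_recordKernel (d₀ : Draw K 𝓧) (r : Record N K 𝓧) {g : Record N K 𝓧 → ℝ≥0∞}
    (hg : Measurable g) :
    ∫⁻ r', g r' ∂S.recordKernel d₀ r =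
      ∫⁻ p, g (!r.1, p) ∂S.fullKernel d₀ (!r.1).toNat (S.nextState r) := by
  rw [recordKernel_apply, lintegral_map hg measurable_prodMk_left]

theorem lintegral_fullKernel_nextState (d₀ : Draw K 𝓧) (b : Bool) (x : State N 𝓧)
    {g : State N 𝓧 → ℝ≥0∞} (hg : Measurable g) :
    ∫⁻ p, g (S.nextState (b, p)) ∂S.fullKernel d₀ b.toNat x =
      ∫⁻ y, g y ∂S.stateKernel b.toNat x := by
  rw [← S.fullKernel_map_communicate d₀,
    Kernel.lintegral_map _ (S.measurable_communicate _) _ hg]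
  rfl

end RecordKernel

section RecordLaw

/-- The stationary law of the record of an iteration of parity `b`. -/
noncomputable def phaseLaw (d₀ : Draw K 𝓧) (b : Bool) : Measure (Record N K 𝓧) :=
  (S.jointπ.bind (S.fullKernel d₀ b.toNat)).map (Prod.mk b)

/-- The stationary law of the chain of records. -/
noncomputable def recordLaw (d₀ : Draw K 𝓧) : Measure (Record N K 𝓧) :=
  (2⁻¹ : ℝ≥0∞) • (S.phaseLaw d₀ false + S.phaseLaw d₀ true)

theorem recordLaw_eq (d₀ : Draw K 𝓧) (b : Bool) :
    S.recordLaw d₀ = (2⁻¹ : ℝ≥0∞) • (S.phaseLaw d₀ b + S.phaseLaw d₀ (!b)) := by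
  cases b
  · rfl
  · exact congrArg _ (add_comm _ _)

theorem lintegral_phaseLaw (d₀ : Draw K 𝓧) (b : Bool) {g : Record N K 𝓧 → ℝ≥0∞}
    (hg : Measurable g) :
    ∫⁻ r, g r ∂S.phaseLaw d₀ b = ∫⁻ x, ∫⁻ p, g (b, p) ∂S.fullKernel d₀ b.toNat x ∂S.jointπ := by
  rw [phaseLaw, lintegral_map hg measurable_prodMk_left]
  exact Measure.lintegral_bind (Kernel.aemeasurable _)
    (hg.comp measurable_prodMk_left).aemeasurable

theorem ae_phaseLaw_fst_eq (d₀ : Draw K 𝓧) (b : Bool) : ∀ᵐ r ∂S.phaseLaw d₀ b, r.1 = b := by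
  have measurableSet_fst_eq : MeasurableSet {r : Record N K 𝓧 | r.1 = b} :=
    measurable_fst (measurableSet_singleton b)
  rw [phaseLaw, ae_map_iff measurable_prodMk_left.aemeasurable measurableSet_fst_eq]
  exact Eventually.of_forall fun _ => rfl

theorem ae_recordLaw_iff (d₀ : Draw K 𝓧) {p : Record N K 𝓧 → Prop} :
    (∀ᵐ r ∂S.recordLaw d₀, p r) ↔ ∀ b, ∀ᵐ r ∂S.phaseLaw d₀ b, p r := by
  rw [recordLaw, Measure.ae_ennreal_smul_measure_iff (by simp), ae_add_measure_iff,
    Bool.forall_bool]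

theorem phaseLaw_absolutelyContinuous_recordLaw (d₀ : Draw K 𝓧) (b : Bool) :
    S.phaseLaw d₀ b ≪ S.recordLaw d₀ :=
  Measure.ae_le_iff_absolutelyContinuous.1 fun _ h => (S.ae_recordLaw_iff d₀).1 h b

variable {S}

theorem Valid.isProbabilityMeasure_phaseLaw (hS : S.Valid) (d₀ : Draw K 𝓧) (b : Bool) :
    IsProbabilityMeasure (S.phaseLaw d₀ b) := by
  have := hS.isProbabilityMeasure_jointπ
  exact Measure.isProbabilityMeasure_map measurable_prodMk_left.aemeasurable

theorem Valid.isProbabilityMeasure_recordLaw (hS : S.Valid) (d₀ : Draw K 𝓧) :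
    IsProbabilityMeasure (S.recordLaw d₀) := by
  have := hS.isProbabilityMeasure_phaseLaw d₀
  refine ⟨?_⟩
  rw [recordLaw, Measure.smul_apply, Measure.add_apply, measure_univ, measure_univ, smul_eq_mul,
    one_add_one_eq_two]
  exact ENNReal.inv_mul_cancel two_ne_zero ENNReal.ofNat_ne_top

theorem Valid.phaseLaw_bind_recordKernel (hS : S.Valid) (d₀ : Draw K 𝓧) (b : Bool) :
    (S.phaseLaw d₀ b).bind (S.recordKernel d₀) = S.phaseLaw d₀ (!b) := by
  refine Measure.ext_of_lintegral _ fun g hg => ?_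
  have measurable_next : Measurable fun x =>
      ∫⁻ p, g (!b, p) ∂S.fullKernel d₀ (!b).toNat x :=
    (hg.comp measurable_prodMk_left).lintegral_kernel
  rw [Measure.lintegral_bind (Kernel.aemeasurable _) hg.aemeasurable,
    S.lintegral_phaseLaw d₀ b hg.lintegral_kernel, S.lintegral_phaseLaw d₀ (!b) hg]
  simp only [S.lintegral_recordKernel d₀ _ hg,
    S.lintegral_fullKernel_nextState d₀ b _ measurable_next]
  rw [← Measure.lintegral_bind (Kernel.aemeasurable _) measurable_next.aemeasurable,
    (hS.invariant_stateKernel b.toNat).def]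

theorem Valid.invariant_recordKernel (hS : S.Valid) (d₀ : Draw K 𝓧) :
    (S.recordKernel d₀).Invariant (S.recordLaw d₀) := by
  rw [Kernel.Invariant, recordLaw, Measure.comp_smul, Measure.comp_add,
    hS.phaseLaw_bind_recordKernel, hS.phaseLaw_bind_recordKernel, Bool.not_false, Bool.not_true,
    add_comm (S.phaseLaw d₀ true)]

theorem Valid.measurePreserving_nextState_phaseLaw (hS : S.Valid) (d₀ : Draw K 𝓧) (b : Bool) :
    MeasurePreserving S.nextState (S.phaseLaw d₀ b) S.jointπ := by
  refine ⟨S.measurable_nextState, Measure.ext_of_lintegral _ fun g hg => ?_⟩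
  have measurable_comp : Measurable fun r : Record N K 𝓧 => g (S.nextState r) :=
    hg.comp S.measurable_nextState
  rw [lintegral_map hg S.measurable_nextState, S.lintegral_phaseLaw d₀ b measurable_comp]
  simp only [S.lintegral_fullKernel_nextState d₀ b _ hg]
  rw [← Measure.lintegral_bind (Kernel.aemeasurable _) hg.aemeasurable,
    (hS.invariant_stateKernel b.toNat).def]

theorem Valid.measurePreserving_nextState (hS : S.Valid) (d₀ : Draw K 𝓧) :
    MeasurePreserving S.nextState (S.recordLaw d₀) S.jointπ := by
  refine ⟨S.measurable_nextState, ?_⟩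
  rw [recordLaw, Measure.map_smul, Measure.map_add _ _ S.measurable_nextState,
    (hS.measurePreserving_nextState_phaseLaw d₀ _).map_eq,
    (hS.measurePreserving_nextState_phaseLaw d₀ _).map_eq, ← two_smul ℝ≥0∞, smul_smul,
    ENNReal.inv_mul_cancel two_ne_zero ENNReal.ofNat_ne_top, one_smul]

/- A harmonic function of the record depends only on the parity and on the next state, and as such
it is harmonic for the chain of states. -/
theorem Valid.isLiouville_recordKernel (hS : S.Valid) (d₀ : Draw K 𝓧) :
    IsLiouville (S.recordKernel d₀) (S.recordLaw d₀) := by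
  intro h hm h_le_one harm
  set k : Bool → State N 𝓧 → ℝ≥0∞ := fun b x =>
    ∫⁻ p, h (!b, p) ∂S.fullKernel d₀ (!b).toNat x
  have measurable_k (b : Bool) : Measurable (k b) :=
    (hm.comp measurable_prodMk_left).lintegral_kernel
  have h_eq (r : Record N K 𝓧) : h r = k r.1 (S.nextState r) := by
    rw [← harm r, S.lintegral_recordKernel d₀ r hm]
  have k_le_one (b : Bool) (x : State N 𝓧) : k b x ≤ 1 :=
    (lintegral_mono fun p => h_le_one _).trans (by simp)
  have harm_k (b : Bool) (x : State N 𝓧) :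
      ∫⁻ y, k (!b) y ∂S.stateKernel (!b).toNat x = k b x := by
    rw [← S.lintegral_fullKernel_nextState d₀ _ x (measurable_k _)]
    exact lintegral_congr fun p => (h_eq (!b, p)).symm
  obtain ⟨c, hc⟩ := hS.ae_eq_const_of_harmonic measurable_k k_le_one harm_k
  refine ⟨c, (S.ae_recordLaw_iff d₀).2 fun b => ?_⟩
  filter_upwards [S.ae_phaseLaw_fst_eq d₀ b,
    (hS.measurePreserving_nextState_phaseLaw d₀ b).quasiMeasurePreserving.ae (hc b)] with r hr hk
  rw [h_eq, hr, hk]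

end RecordLaw

section RecordChain

variable {S} {Ω : Type*}

/-- The records of a run, where `record d₀ Y D s` is the record of iteration `s + 1`. -/
def record (d₀ : Draw K 𝓧) (Y : ℕ → Ω → State N 𝓧) (D : ℕ → Fin N → Ω → Draw K 𝓧)
    (s : ℕ) (ω : Ω) : Record N K 𝓧 :=
  ((s + 1).bodd, Y (s + 1) ω, extendDraw d₀ (s + 1) fun j => D (s + 1) j.1 ω)

theorem measurable_record {m : MeasurableSpace Ω} (d₀ : Draw K 𝓧)
    {Y : ℕ → Ω → State N 𝓧} {D : ℕ → Fin N → Ω → Draw K 𝓧} {s : ℕ} (hY : Measurable (Y (s + 1)))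
    (hD : ∀ j, Proposed (s + 1) j → Measurable (D (s + 1) j)) : Measurable (record d₀ Y D s) := by
  have measurable_draws :
      Measurable fun ω => fun j : {j : Fin N // Proposed (s + 1) j} => D (s + 1) j.1 ω :=
    measurable_pi_lambda _ fun j => hD j.1 j.2
  exact measurable_const.prodMk
    (hY.prodMk ((measurable_extendDraw d₀ (s + 1)).comp measurable_draws))

theorem record_draw_of_proposed {α : Type*} (d₀ : Draw K α) (Y : ℕ → Ω → State N α)
    (D : ℕ → Fin N → Ω → Draw K α) {s : ℕ} {j : Fin N} (hj : Proposed (s + 1) j) (ω : Ω) :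
    (record d₀ Y D s ω).2.2 j = D (s + 1) j ω :=
  dif_pos hj

variable {mΩ : MeasurableSpace Ω} {μ : Measure Ω} {ℱ : Filtration ℕ mΩ}
  {X Y : ℕ → Ω → State N 𝓧} {D : ℕ → Fin N → Ω → Draw K 𝓧}

/-- The filtration `ℱ` started at time `1`, to which the records are adapted. -/
def tailFiltration (ℱ : Filtration ℕ mΩ) : Filtration ℕ mΩ where
  seq s := ℱ (s + 1)
  mono' _ _ h := ℱ.mono (Nat.succ_le_succ h)
  le' s := ℱ.le (s + 1)

theorem IsRun.ae_eq_nextState (hrun : S.IsRun μ ℱ X Y D) (d₀ : Draw K 𝓧) (s : ℕ) :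
    ∀ᵐ ω ∂μ, X (s + 1) ω = S.nextState (record d₀ Y D s ω) := by
  filter_upwards [hrun.update s] with ω hω
  rw [hω, nextState, record, S.communicate_congr (bodd_toNat_modEq (s + 1)),
    communicate_eq_swapAll, communicate_eq_swapAll]
  exact S.swapAll_congr
    (fun j hj => (record_draw_of_proposed d₀ Y D (mem_proposedSwaps.1 hj) ω).symm) _

theorem IsRun.measurable_record (hrun : S.IsRun μ ℱ X Y D) (d₀ : Draw K 𝓧) (s : ℕ) :
    Measurable[ℱ (s + 1)] (record d₀ Y D s) :=
  Data.measurable_record (m := ℱ (s + 1)) d₀ (hrun.measurable_Y s) (hrun.measurable_D s)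

theorem IsRun.measure_inter_record (hrun : S.IsRun μ ℱ X Y D) (d₀ : Draw K 𝓧) (s : ℕ) {A : Set Ω}
    (hA : MeasurableSet[ℱ s] A) {B : Set (Record N K 𝓧)} (hB : MeasurableSet B) :
    μ (A ∩ record d₀ Y D s ⁻¹' B) =
      ∫⁻ ω in A, ((S.fullKernel d₀ (s + 1) (X s ω)).map (Prod.mk (s + 1).bodd)) B ∂μ := by
  have hmap := measurable_prodMap_extendDraw (N := N) d₀ (s + 1)
  have hB' : MeasurableSet (Prod.mk (s + 1).bodd ⁻¹' B) := measurable_prodMk_left hB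
  refine (hrun.sample s A hA _ (hmap hB')).trans (lintegral_congr fun ω => ?_)
  rw [← S.iterKernel_map_extendDraw d₀ (s + 1), Measure.map_apply measurable_prodMk_left hB,
    Kernel.map_apply' _ hmap _ hB']

theorem IsRun.isMarkovChain_record (hrun : S.IsRun μ ℱ X Y D) (d₀ : Draw K 𝓧) :
    IsMarkovChain (S.recordKernel d₀) μ (tailFiltration ℱ) (record d₀ Y D) where
  adapted s := hrun.measurable_record d₀ s
  markov s A hA B hB := by
    rw [hrun.measure_inter_record d₀ (s + 1) hA hB]
    refine lintegral_congr_ae (ae_restrict_of_ae ?_)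
    filter_upwards [hrun.ae_eq_nextState d₀ s] with ω hω
    have bodd_eq : (s + 1 + 1).bodd = !(record d₀ Y D s ω).1 := Nat.bodd_succ _
    rw [recordKernel_apply, ← hω, ← bodd_eq, S.fullKernel_congr d₀ (bodd_toNat_modEq _)]

theorem IsRun.map_record_zero (hrun : S.IsRun μ ℱ X Y D) (d₀ : Draw K 𝓧) :
    μ.map (record d₀ Y D 0) =
      ((μ.map (X 0)).bind (S.fullKernel d₀ 1)).map (Prod.mk true) := by
  have measurable_X_zero : Measurable (X 0) := (hrun.measurable_X 0).mono (ℱ.le 0) le_rfl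
  have measurable_record_zero : Measurable (record d₀ Y D 0) :=
    (hrun.measurable_record d₀ 0).mono (ℱ.le 1) le_rfl
  ext B hB
  have measure_eq := hrun.measure_inter_record d₀ 0 MeasurableSet.univ hB
  rw [Set.univ_inter, Measure.restrict_univ] at measure_eq
  rw [Measure.map_apply measurable_record_zero hB, measure_eq,
    Measure.map_apply measurable_prodMk_left hB,
    Measure.bind_apply (measurable_prodMk_left hB) (Kernel.aemeasurable _),
    lintegral_map (Kernel.measurable_coe _ (measurable_prodMk_left hB)) measurable_X_zero]
  exact lintegral_congr fun ω => Measure.map_apply measurable_prodMk_left hB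

theorem IsRun.map_record_zero_absolutelyContinuous (hrun : S.IsRun μ ℱ X Y D) (d₀ : Draw K 𝓧) :
    μ.map (record d₀ Y D 0) ≪ S.recordLaw d₀ := by
  rw [hrun.map_record_zero d₀]
  exact ((hrun.init.comp_right _).map measurable_prodMk_left).trans
    (S.phaseLaw_absolutelyContinuous_recordLaw d₀ true)

end RecordChain

end Data

theorem exists_proposed_and_not_proposed_not {N : ℕ} (j : Fin N) :
    ∃ b : Bool, Proposed b.toNat j ∧ ¬ Proposed (!b).toNat j := by
  unfold Proposed Nat.ModEq
  rcases Nat.mod_two_eq_zero_or_one ((j : ℕ) + 1) with h | h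
  · exact ⟨false, by simp [h]⟩
  · exact ⟨true, by simp [h]⟩

theorem sum_Icc_one_eq_sum_range {M : Type*} [AddCommMonoid M] (g : ℕ → M) (T : ℕ) :
    ∑ t ∈ Finset.Icc 1 T, g t = ∑ s ∈ Finset.range T, g (s + 1) := by
  rw [Finset.range_eq_Ico, Finset.sum_Ico_add' g 0 T 1]
  rfl

theorem log_prod_mul_sum_exp {ι τ : Type*} [Fintype ι] {s : ι → Finset τ}
    (hs : ∀ j, (s j).Nonempty) {c : ι → ℝ} (hc : ∀ j, c j ≠ 0) {g : ι → τ → ℝ} {a : ι → ℝ}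
    (hg : ∀ j, ∀ t ∈ s j, g j t = a j) :
    Real.log (∏ j, c j * ∑ t ∈ s j, Real.exp (g j t)) =
      Real.log (∏ j, c j * (s j).card) + ∑ j, a j := by
  have prod_eq : ∏ j, c j * ∑ t ∈ s j, Real.exp (g j t) =
      (∏ j, c j * (s j).card) * Real.exp (∑ j, a j) := by
    rw [Real.exp_sum, ← Finset.prod_mul_distrib]
    refine Finset.prod_congr rfl fun j _ => ?_
    rw [Finset.sum_congr rfl fun t ht => congrArg Real.exp (hg j t ht), Finset.sum_const,
      nsmul_eq_mul, mul_assoc]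
  have prod_ne_zero : ∏ j, c j * ((s j).card : ℝ) ≠ 0 :=
    Finset.prod_ne_zero_iff.2 fun j _ =>
      mul_ne_zero (hc j) (Nat.cast_ne_zero.2 (hs j).card_ne_zero)
  rw [prod_eq, Real.log_mul prod_ne_zero (Real.exp_pos _).ne', Real.log_exp]

theorem tendsto_log_prod_of_tendsto_exp {ι β : Type*} [Fintype ι] {l : Filter β}
    {u : ι → β → ℝ} {a : ι → ℝ} (hu : ∀ j, Tendsto (u j) l (𝓝 (Real.exp (a j)))) :
    Tendsto (fun T => Real.log (∏ j, u j T)) l (𝓝 (∑ j, a j)) := by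
  have tendsto_prod := tendsto_finsetProd Finset.univ fun j _ => hu j
  rw [← Real.exp_sum] at tendsto_prod
  simpa only [Real.log_exp] using tendsto_prod.log (Real.exp_pos _).ne'

namespace Data

variable {N K : ℕ} {S : Data N K 𝓧}

section DrawLaw

/-- The stationary law of the draw for the swap `j`. -/
noncomputable def drawLaw (S : Data N K 𝓧) (j : Fin N) : Measure (Draw K 𝓧) :=
  (S.fwdLaw j).prod ((S.bwdLaw j).prod volume)

theorem fullKernel_map_draw (S : Data N K 𝓧) (d₀ : Draw K 𝓧) {t : ℕ} {j : Fin N}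
    (hj : Proposed t j) :
    (S.fullKernel d₀ t).map (fun p => p.2 j) = S.drawKernel j ∘ₖ S.exploreKernel := by
  rw [← S.drawOr_of_proposed d₀ hj, ← prodKernel_map_eval (S.drawOr d₀ t) j, ← Kernel.map_comp,
    ← Kernel.snd_compProd_prodMkLeft, Kernel.snd_eq,
    ← Kernel.map_comp_right _ measurable_snd (measurable_pi_apply j)]
  rfl

theorem Valid.jointπ_bind_drawKernel (hS : S.Valid) (j : Fin N) :
    S.jointπ.bind (S.drawKernel j) = S.drawLaw j := by
  have := hS.isProbabilityMeasure_π
  have measurable_pair : Measurable fun y : State N 𝓧 => (y j.castSucc, y j.succ) := by fun_prop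
  have drawKernel_eq :
      S.drawKernel j = S.pairDraw j ∘ₖ Kernel.deterministic _ measurable_pair := by
    ext1 y
    rw [Kernel.comp_deterministic_eq_comap, Kernel.comap_apply, drawKernel_apply]
  rw [drawKernel_eq, ← Measure.comp_assoc, Measure.deterministic_comp_eq_map, jointπ,
    pi_map_eval_pair S.π Fin.castSucc_lt_succ.ne, prod_bind_pairDraw]
  rfl

theorem Valid.measurePreserving_draw (hS : S.Valid) (d₀ : Draw K 𝓧) {b : Bool} {j : Fin N}
    (hj : Proposed b.toNat j) :
    MeasurePreserving (fun r => r.2.2 j) (S.phaseLaw d₀ b) (S.drawLaw j) := by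
  have measurable_draw : Measurable fun p : State N 𝓧 × (Fin N → Draw K 𝓧) => p.2 j := by
    fun_prop
  refine ⟨by fun_prop, ?_⟩
  rw [phaseLaw, Measure.map_map (by fun_prop) measurable_prodMk_left]
  refine (Measure.map_comp _ _ measurable_draw).trans ?_
  rw [S.fullKernel_map_draw d₀ hj, ← Measure.comp_assoc, hS.invariant_exploreKernel.def,
    hS.jointπ_bind_drawKernel]

end DrawLaw

section DrawValue

/-- The value of `G` at the draw for the swap `j`, set to zero if the swap is not proposed, so that
sums over the iterations proposing the swap become sums along the chain of records. -/
noncomputable def drawValue (j : Fin N) (G : Draw K 𝓧 → ℝ) (r : Record N K 𝓧) : ℝ :=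
  if Proposed r.1.toNat j then G (r.2.2 j) else 0

theorem drawValue_ae_eq_of_proposed (S : Data N K 𝓧) (d₀ : Draw K 𝓧) {b : Bool} {j : Fin N}
    (hj : Proposed b.toNat j) (G : Draw K 𝓧 → ℝ) :
    drawValue j G =ᵐ[S.phaseLaw d₀ b] fun r => G (r.2.2 j) := by
  filter_upwards [S.ae_phaseLaw_fst_eq d₀ b] with r hr
  rw [drawValue, hr, if_pos hj]

theorem drawValue_ae_eq_zero (S : Data N K 𝓧) (d₀ : Draw K 𝓧) {b : Bool} {j : Fin N}
    (hj : ¬ Proposed b.toNat j) (G : Draw K 𝓧 → ℝ) :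
    drawValue j G =ᵐ[S.phaseLaw d₀ b] fun _ => 0 := by
  filter_upwards [S.ae_phaseLaw_fst_eq d₀ b] with r hr
  rw [drawValue, hr, if_neg hj]

theorem Valid.integrable_drawValue_phaseLaw (hS : S.Valid) (d₀ : Draw K 𝓧) (b : Bool) {j : Fin N}
    {G : Draw K 𝓧 → ℝ} (hG : Integrable G (S.drawLaw j)) :
    Integrable (drawValue j G) (S.phaseLaw d₀ b) := by
  by_cases hj : Proposed b.toNat j
  · exact ((hS.measurePreserving_draw d₀ hj).integrable_comp_of_integrable hG).congr
      (S.drawValue_ae_eq_of_proposed d₀ hj G).symm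
  · exact (integrable_zero _ _ _).congr (S.drawValue_ae_eq_zero d₀ hj G).symm

theorem Valid.integrable_drawValue (hS : S.Valid) (d₀ : Draw K 𝓧) {j : Fin N}
    {G : Draw K 𝓧 → ℝ} (hG : Integrable G (S.drawLaw j)) :
    Integrable (drawValue j G) (S.recordLaw d₀) :=
  ((hS.integrable_drawValue_phaseLaw d₀ _ hG).add_measure
    (hS.integrable_drawValue_phaseLaw d₀ _ hG)).smul_measure (by simp)

theorem Valid.integral_drawValue (hS : S.Valid) (d₀ : Draw K 𝓧) {j : Fin N}
    {G : Draw K 𝓧 → ℝ} (hG : Integrable G (S.drawLaw j)) :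
    ∫ r, drawValue j G r ∂S.recordLaw d₀ = 2⁻¹ * ∫ d, G d ∂S.drawLaw j := by
  obtain ⟨b, hb, hb'⟩ := exists_proposed_and_not_proposed_not j
  have integral_draw : ∫ r, G (r.2.2 j) ∂S.phaseLaw d₀ b = ∫ d, G d ∂S.drawLaw j :=
    (hS.measurePreserving_draw d₀ hb).hasLaw.integral_comp hG.aestronglyMeasurable
  rw [S.recordLaw_eq d₀ b, integral_smul_measure,
    integral_add_measure (hS.integrable_drawValue_phaseLaw d₀ _ hG)
      (hS.integrable_drawValue_phaseLaw d₀ _ hG),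
    integral_congr_ae (S.drawValue_ae_eq_of_proposed d₀ hb G),
    integral_congr_ae (S.drawValue_ae_eq_zero d₀ hb' G), integral_zero, add_zero, integral_draw,
    ENNReal.toReal_inv, ENNReal.toReal_ofNat, smul_eq_mul]

end DrawValue

section Work

theorem Valid.exp_neg_work_ae_eq (hS : S.Valid) (j : Fin N) :
    (fun x => Real.exp (-S.work j x)) =ᵐ[S.fwdLaw j] fun x =>
      Real.exp (-S.ΔFstep j) * ((S.bwdLaw j).rnDeriv (S.fwdLaw j) x).toReal := by
  filter_upwards [hS.ae_rnDeriv_pos_lt_top j] with x hx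
  rw [work, neg_sub', sub_neg_eq_add, Real.exp_add,
    Real.exp_log (ENNReal.toReal_pos hx.1.ne' hx.2.ne)]

theorem Valid.exp_work_ae_eq (hS : S.Valid) (j : Fin N) :
    (fun x => Real.exp (S.work j x)) =ᵐ[S.bwdLaw j] fun x =>
      Real.exp (S.ΔFstep j) * ((S.fwdLaw j).rnDeriv (S.bwdLaw j) x).toReal := by
  have := hS.isProbabilityMeasure_fwdLaw j
  have := hS.isProbabilityMeasure_bwdLaw j
  filter_upwards [(hS.bwd_ac_fwd j).ae_le (hS.ae_rnDeriv_pos_lt_top j),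
    Measure.inv_rnDeriv (hS.bwd_ac_fwd j)] with x hx inv_rnDeriv_eq
  rw [work, Real.exp_sub, Real.exp_log (ENNReal.toReal_pos hx.1.ne' hx.2.ne), ← inv_rnDeriv_eq,
    Pi.inv_apply, ENNReal.toReal_inv, div_eq_mul_inv]

theorem Valid.integrable_exp_neg_work (hS : S.Valid) (j : Fin N) :
    Integrable (fun x => Real.exp (-S.work j x)) (S.fwdLaw j) := by
  have := hS.isProbabilityMeasure_bwdLaw j
  exact (Measure.integrable_toReal_rnDeriv.const_mul _).congr (hS.exp_neg_work_ae_eq j).symm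

theorem Valid.integrable_exp_work (hS : S.Valid) (j : Fin N) :
    Integrable (fun x => Real.exp (S.work j x)) (S.bwdLaw j) := by
  have := hS.isProbabilityMeasure_fwdLaw j
  exact (Measure.integrable_toReal_rnDeriv.const_mul _).congr (hS.exp_work_ae_eq j).symm

theorem Valid.integral_exp_neg_work (hS : S.Valid) (j : Fin N) :
    ∫ x, Real.exp (-S.work j x) ∂S.fwdLaw j = Real.exp (-S.ΔFstep j) := by
  have := hS.isProbabilityMeasure_fwdLaw j
  have := hS.isProbabilityMeasure_bwdLaw j
  rw [integral_congr_ae (hS.exp_neg_work_ae_eq j), integral_const_mul,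
    Measure.integral_toReal_rnDeriv (hS.bwd_ac_fwd j), probReal_univ, mul_one]

theorem Valid.integral_exp_work (hS : S.Valid) (j : Fin N) :
    ∫ x, Real.exp (S.work j x) ∂S.bwdLaw j = Real.exp (S.ΔFstep j) := by
  have := hS.isProbabilityMeasure_fwdLaw j
  have := hS.isProbabilityMeasure_bwdLaw j
  rw [integral_congr_ae (hS.exp_work_ae_eq j), integral_const_mul,
    Measure.integral_toReal_rnDeriv (hS.fwd_ac_bwd j), probReal_univ, mul_one]

theorem Valid.ae_work_eq_ΔFstep (hS : S.Valid) {j : Fin N} (heq : S.fwdLaw j = S.bwdLaw j) :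
    ∀ᵐ x ∂S.fwdLaw j, S.work j x = S.ΔFstep j := by
  have := hS.isProbabilityMeasure_fwdLaw j
  filter_upwards [Measure.rnDeriv_self (S.fwdLaw j)] with x hx
  rw [work, ← heq, hx, ENNReal.toReal_one, Real.log_one, sub_zero]

theorem Valid.ae_drawLaw_work_eq_ΔFstep (hS : S.Valid) {j : Fin N}
    (heq : S.fwdLaw j = S.bwdLaw j) :
    ∀ᵐ d ∂S.drawLaw j, S.work j d.1 = S.ΔFstep j ∧ S.work j d.2.1 = S.ΔFstep j := by
  have := hS.isProbabilityMeasure_fwdLaw j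
  have := hS.isProbabilityMeasure_bwdLaw j
  have ae_fwd := hS.ae_work_eq_ΔFstep heq
  have ae_bwd : ∀ᵐ x ∂S.bwdLaw j, S.work j x = S.ΔFstep j := heq ▸ ae_fwd
  filter_upwards [Measure.quasiMeasurePreserving_fst.ae ae_fwd,
    Measure.quasiMeasurePreserving_snd.ae (Measure.quasiMeasurePreserving_fst.ae ae_bwd)]
    with d hd hd' using ⟨hd, hd'⟩

theorem sum_ΔFstep (S : Data N K 𝓧) : ∑ j, S.ΔFstep j = S.ΔF := by
  have sum_castSucc := Fin.sum_univ_castSucc fun n => Real.log (S.Z n)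
  have sum_succ := Fin.sum_univ_succ fun n => Real.log (S.Z n)
  simp only [ΔFstep, ΔF, Finset.sum_sub_distrib]
  linarith

end Work

section FreeEnergy

variable {Ω : Type*} {D : ℕ → Fin N → Ω → Draw K 𝓧}

/- The number of summands of each factor is the same in the forward and in the backward estimator,
so it cancels in their mean. -/
theorem freeEnergy_eq_ΔF_of_work_eq (S : Data N K 𝓧) {T : ℕ}
    (hT : ∀ j : Fin N, ∃ t ∈ Finset.Icc 1 T, Proposed t j) {ω : Ω}
    (hω : ∀ j, ∀ t ∈ (Finset.Icc 1 T).filter (Proposed · j),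
      S.work j (D t j ω).1 = S.ΔFstep j ∧ S.work j (D t j ω).2.1 = S.ΔFstep j) :
    S.freeEnergy D T ω = S.ΔF := by
  have factor_ne_zero (j : Fin N) : (2 : ℝ) / T ≠ 0 := by
    obtain ⟨t, ht, -⟩ := hT j
    have T_pos : 1 ≤ T := Finset.nonempty_Icc.1 ⟨t, ht⟩
    positivity
  have nonempty_proposed (j : Fin N) : ((Finset.Icc 1 T).filter (Proposed · j)).Nonempty :=
    Finset.filter_nonempty_iff.2 (hT j)
  rw [freeEnergy, fwdFreeEnergy, bwdFreeEnergy,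
    log_prod_mul_sum_exp nonempty_proposed factor_ne_zero fun j t ht =>
      congrArg Neg.neg (hω j t ht).1,
    log_prod_mul_sum_exp nonempty_proposed factor_ne_zero fun j t ht => (hω j t ht).2,
    Finset.sum_neg_distrib, sum_ΔFstep]
  ring

end FreeEnergy

section Run

theorem Valid.nonempty_draw (hS : S.Valid) : Nonempty (Draw K 𝓧) := by
  have := hS.isProbabilityMeasure_π 0
  obtain ⟨x⟩ := (S.π 0).nonempty_of_neZero
  exact ⟨(fun _ => x, fun _ => x, 0)⟩

variable {Ω : Type*} {mΩ : MeasurableSpace Ω} {μ : Measure Ω} {ℱ : Filtration ℕ mΩ}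
  {X Y : ℕ → Ω → State N 𝓧} {D : ℕ → Fin N → Ω → Draw K 𝓧}

theorem sum_proposed_eq_sum_drawValue {α : Type*} (d₀ : Draw K α) (Y : ℕ → Ω → State N α)
    (D : ℕ → Fin N → Ω → Draw K α) (j : Fin N) (G : Draw K α → ℝ) (T : ℕ) (ω : Ω) :
    ∑ t ∈ Finset.Icc 1 T with Proposed t j, G (D t j ω) =
      ∑ s ∈ Finset.range T, drawValue j G (record d₀ Y D s ω) := by
  rw [Finset.sum_filter, sum_Icc_one_eq_sum_range]
  refine Finset.sum_congr rfl fun s _ => ?_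
  have proposed_iff : Proposed (record d₀ Y D s ω).1.toNat j ↔ Proposed (s + 1) j :=
    proposed_congr (bodd_toNat_modEq (s + 1)) j
  by_cases hj : Proposed (s + 1) j
  · rw [if_pos hj, drawValue, if_pos (proposed_iff.2 hj), record_draw_of_proposed d₀ Y D hj]
  · rw [if_neg hj, drawValue, if_neg (mt proposed_iff.1 hj)]

theorem IsRun.ae_draw (hrun : S.IsRun μ ℱ X Y D) (hS : S.Valid) {t : ℕ} (ht : 1 ≤ t) {j : Fin N}
    (hj : Proposed t j) {p : Draw K 𝓧 → Prop} (hp : ∀ᵐ d ∂S.drawLaw j, p d) :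
    ∀ᵐ ω ∂μ, p (D t j ω) := by
  obtain ⟨d₀⟩ := hS.nonempty_draw
  obtain ⟨s, rfl⟩ := Nat.exists_eq_add_of_le' ht
  have map_record_ac : μ.map (record d₀ Y D s) ≪ S.recordLaw d₀ :=
    (hrun.isMarkovChain_record d₀).map_absolutelyContinuous (hS.invariant_recordKernel d₀)
      (hrun.map_record_zero_absolutelyContinuous d₀) s
  have ae_recordLaw : ∀ᵐ r ∂S.recordLaw d₀, Proposed r.1.toNat j → p (r.2.2 j) := by
    refine (S.ae_recordLaw_iff d₀).2 fun b => ?_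
    by_cases hb : Proposed b.toNat j
    · filter_upwards [(hS.measurePreserving_draw d₀ hb).quasiMeasurePreserving.ae hp]
        with r hr _ using hr
    · filter_upwards [S.ae_phaseLaw_fst_eq d₀ b] with r hr hr_proposed
      exact absurd (hr ▸ hr_proposed) hb
  have measurable_record : Measurable (record d₀ Y D s) :=
    (hrun.measurable_record d₀ s).mono (ℱ.le _) le_rfl
  filter_upwards [ae_of_ae_map measurable_record.aemeasurable (map_record_ac.ae_le ae_recordLaw)]
    with ω hω
  rw [← record_draw_of_proposed d₀ Y D hj]
  exact hω ((proposed_congr (bodd_toNat_modEq (s + 1)) j).2 hj)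

theorem IsRun.ae_freeEnergy_eq (hrun : S.IsRun μ ℱ X Y D) (hS : S.Valid)
    (heq : ∀ j, S.fwdLaw j = S.bwdLaw j) {T : ℕ}
    (hT : ∀ j : Fin N, ∃ t ∈ Finset.Icc 1 T, Proposed t j) :
    ∀ᵐ ω ∂μ, S.freeEnergy D T ω = S.ΔF := by
  have ae_work : ∀ᵐ ω ∂μ, ∀ j, ∀ t ∈ (Finset.Icc 1 T).filter (Proposed · j),
      S.work j (D t j ω).1 = S.ΔFstep j ∧ S.work j (D t j ω).2.1 = S.ΔFstep j := by
    refine ae_all_iff.2 fun j => (ae_ball_iff (Finset.countable_toSet _)).2 fun t ht => ?_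
    obtain ⟨ht, hj⟩ := Finset.mem_filter.1 ht
    exact hrun.ae_draw hS (Finset.mem_Icc.1 ht).1 hj (hS.ae_drawLaw_work_eq_ΔFstep (heq j))
  filter_upwards [ae_work] with ω hω using S.freeEnergy_eq_ΔF_of_work_eq hT hω

variable [IsFiniteMeasure μ]

theorem IsRun.ae_tendsto_average (hrun : S.IsRun μ ℱ X Y D) (hS : S.Valid) (d₀ : Draw K 𝓧)
    {f : Record N K 𝓧 → ℝ} (hf : Integrable f (S.recordLaw d₀)) :
    ∀ᵐ ω ∂μ, Tendsto (fun T : ℕ => (1 / (T : ℝ)) * ∑ s ∈ Finset.range T, f (record d₀ Y D s ω))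
      atTop (𝓝 (∫ r, f r ∂S.recordLaw d₀)) := by
  have := hS.isProbabilityMeasure_recordLaw d₀
  exact (hrun.isMarkovChain_record d₀).ae_tendsto_average (hS.isLiouville_recordKernel d₀)
    (hS.invariant_recordKernel d₀) (hrun.map_record_zero_absolutelyContinuous d₀) hf

theorem IsRun.ae_tendsto_chainAverage (hrun : S.IsRun μ ℱ X Y D) (hS : S.Valid)
    (n : Fin (N + 1)) {f : 𝓧 → ℝ} (hf : Integrable f (S.π n)) :
    ∀ᵐ ω ∂μ, Tendsto (fun T => chainAverage X n f T ω) atTop (𝓝 (∫ x, f x ∂S.π n)) := by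
  have := hS.isProbabilityMeasure_π
  obtain ⟨d₀⟩ := hS.nonempty_draw
  have measurePreserving_chain :
      MeasurePreserving (fun r => S.nextState r n) (S.recordLaw d₀) (S.π n) :=
    (measurePreserving_eval S.π n).comp (hS.measurePreserving_nextState d₀)
  have integral_chain : ∫ r, f (S.nextState r n) ∂S.recordLaw d₀ = ∫ x, f x ∂S.π n :=
    measurePreserving_chain.hasLaw.integral_comp hf.aestronglyMeasurable
  filter_upwards [hrun.ae_tendsto_average hS d₀
      (measurePreserving_chain.integrable_comp_of_integrable hf),
    ae_all_iff.2 (hrun.ae_eq_nextState d₀)] with ω tendsto_ω eq_nextState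
  rw [← integral_chain]
  refine tendsto_ω.congr fun T => ?_
  rw [chainAverage, sum_Icc_one_eq_sum_range]
  simp only [eq_nextState, Function.comp_apply]

theorem IsRun.ae_tendsto_drawAverage (hrun : S.IsRun μ ℱ X Y D) (hS : S.Valid) {j : Fin N}
    {G : Draw K 𝓧 → ℝ} (hG : Integrable G (S.drawLaw j)) :
    ∀ᵐ ω ∂μ, Tendsto
      (fun T : ℕ => (2 / (T : ℝ)) * ∑ t ∈ Finset.Icc 1 T with Proposed t j, G (D t j ω))
      atTop (𝓝 (∫ d, G d ∂S.drawLaw j)) := by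
  obtain ⟨d₀⟩ := hS.nonempty_draw
  filter_upwards [hrun.ae_tendsto_average hS d₀ (hS.integrable_drawValue d₀ hG)] with ω hω
  have tendsto_two_mul := hω.const_mul 2
  rw [hS.integral_drawValue d₀ hG, mul_inv_cancel_left₀ two_ne_zero] at tendsto_two_mul
  refine tendsto_two_mul.congr fun T => ?_
  rw [sum_proposed_eq_sum_drawValue d₀ Y]
  ring

theorem IsRun.ae_tendsto_exp_neg_work (hrun : S.IsRun μ ℱ X Y D) (hS : S.Valid) (j : Fin N) :
    ∀ᵐ ω ∂μ, Tendsto (fun T : ℕ => (2 / (T : ℝ)) *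
        ∑ t ∈ Finset.Icc 1 T with Proposed t j, Real.exp (-S.work j (D t j ω).1))
      atTop (𝓝 (Real.exp (-S.ΔFstep j))) := by
  have := hS.isProbabilityMeasure_fwdLaw j
  have := hS.isProbabilityMeasure_bwdLaw j
  have integral_draw : ∫ d, Real.exp (-S.work j d.1) ∂S.drawLaw j = Real.exp (-S.ΔFstep j) := by
    rw [drawLaw, integral_fun_fst fun x => Real.exp (-S.work j x), hS.integral_exp_neg_work,
      probReal_univ, one_smul]
  rw [← integral_draw]
  exact hrun.ae_tendsto_drawAverage hS ((hS.integrable_exp_neg_work j).comp_fst _)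

theorem IsRun.ae_tendsto_exp_work (hrun : S.IsRun μ ℱ X Y D) (hS : S.Valid) (j : Fin N) :
    ∀ᵐ ω ∂μ, Tendsto (fun T : ℕ => (2 / (T : ℝ)) *
        ∑ t ∈ Finset.Icc 1 T with Proposed t j, Real.exp (S.work j (D t j ω).2.1))
      atTop (𝓝 (Real.exp (S.ΔFstep j))) := by
  have := hS.isProbabilityMeasure_fwdLaw j
  have := hS.isProbabilityMeasure_bwdLaw j
  have integral_draw : ∫ d, Real.exp (S.work j d.2.1) ∂S.drawLaw j = Real.exp (S.ΔFstep j) := by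
    rw [drawLaw, integral_fun_snd fun z : Path K 𝓧 × unitInterval => Real.exp (S.work j z.1),
      integral_fun_fst fun x => Real.exp (S.work j x), hS.integral_exp_work, probReal_univ,
      probReal_univ, one_smul, one_smul]
  rw [← integral_draw]
  exact hrun.ae_tendsto_drawAverage hS (((hS.integrable_exp_work j).comp_fst _).comp_snd _)

theorem IsRun.ae_tendsto_freeEnergy (hrun : S.IsRun μ ℱ X Y D) (hS : S.Valid) :
    ∀ᵐ ω ∂μ, Tendsto (fun T => S.freeEnergy D T ω) atTop (𝓝 S.ΔF) := by
  filter_upwards [ae_all_iff.2 (hrun.ae_tendsto_exp_neg_work hS),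
    ae_all_iff.2 (hrun.ae_tendsto_exp_work hS)] with ω tendsto_fwd tendsto_bwd
  have tendsto_fwdFreeEnergy : Tendsto (fun T => S.fwdFreeEnergy D T ω) atTop (𝓝 S.ΔF) := by
    have tendsto_log := tendsto_log_prod_of_tendsto_exp tendsto_fwd
    rw [Finset.sum_neg_distrib, sum_ΔFstep] at tendsto_log
    simpa only [fwdFreeEnergy, neg_neg] using tendsto_log.neg
  have tendsto_bwdFreeEnergy : Tendsto (fun T => S.bwdFreeEnergy D T ω) atTop (𝓝 S.ΔF) := by
    rw [← sum_ΔFstep]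
    exact tendsto_log_prod_of_tendsto_exp tendsto_bwd
  simpa only [freeEnergy, add_self_div_two] using
    (tendsto_fwdFreeEnergy.add tendsto_bwdFreeEnergy).div_const 2

end Run

end Data

end AccelPT

theorem mainTheorem4 {N K : ℕ} {𝓧 : Type*} [MeasurableSpace 𝓧]
    (S : AccelPT.Data N K 𝓧) (hS : S.Valid)
    {Ω : Type*} {mΩ : MeasurableSpace Ω} (μ : Measure Ω) [IsProbabilityMeasure μ]
    (ℱ : Filtration ℕ mΩ) (X Y : ℕ → Ω → AccelPT.State N 𝓧)
    (D : ℕ → Fin N → Ω → AccelPT.Draw K 𝓧) (hrun : S.IsRun μ ℱ X Y D) :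
    (∀ (n : Fin (N + 1)) (f : 𝓧 → ℝ), Integrable f (S.π n) →
      ∀ᵐ ω ∂μ, Tendsto (fun T => AccelPT.chainAverage X n f T ω) atTop (𝓝 (∫ x, f x ∂S.π n))) ∧
    (∀ᵐ ω ∂μ, Tendsto (fun T => S.freeEnergy D T ω) atTop (𝓝 S.ΔF)) ∧
    ((∀ j, S.fwdLaw j = S.bwdLaw j) →
      ∀ T : ℕ, (∀ j : Fin N, ∃ t ∈ Finset.Icc 1 T, AccelPT.Proposed t j) →
        ∀ᵐ ω ∂μ, S.freeEnergy D T ω = S.ΔF) := by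
  exact ⟨fun n _ hf => hrun.ae_tendsto_chainAverage hS n hf, hrun.ae_tendsto_freeEnergy hS,
    fun heq _ hT => hrun.ae_freeEnergy_eq hS heq hT⟩
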